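/- Let $V$ be a finite set (e.g. the vertex set of a graph) with $m=\mathrm{card}(V)\ge 1$, let $\Pi$ be the uniform distribution on $V$, and let $\mathcal S_V$ be the space of symmetric kernels $S:V\times V\to\mathbb R$ (real symmetric $m\times m$ matrices). For a kernel $A$ put $\|A\|_{L_2(\Pi^2)}^2=m^{-2}\sum_{u,v\in V}|A(u,v)|^2$; for $S\in\mathcal S_V$ let $\|S\|_1$ be the nuclear norm (the sum of the absolute values of the eigenvalues) and let $\mathrm{supp}(S)\subset\mathbb R^V$ be the span of the eigenvectors of $S$ with nonzero eigenvalues. $P_L$ denotes the orthogonal projector onto a subspace $L\subset\mathbb R^V$, and $\{e_v\}_{v\in V}$ the canonical basis of $\mathbb R^V$. Let $S_*\in\mathcal S_V$ with $\mathrm{rank}(S_*)\ge1$, and let $(X_j,X_j',Y_j)$, $j=1,\dots,n$, be i.i.d. copies of a random triple $(X,X',Y)\in V\times V\times\{-1,1\}$, where $X,X'$ are independent with distribution $\Pi$ and $\mathbb E(Y\mid X=u,X'=v)=S_*(u,v)$ for all $u,v\in V$. Let $W=\sum_{k=1}^m\lambda_k(\phi_k\otimes\phi_k)$ be a symmetric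 nonnegative definite matrix, where $0\le\lambda_1\le\dots\le\lambda_m$ and $\phi_1,\dots,\phi_m$ are orthonormal, and suppose $W\ne0$. Let $k_0$ be the smallest $k$ with $\lambda_k>0$. Assume that for some $c>0$ and $\zeta\ge1$: $\lambda_m\le m^{\zeta}$ and $\lambda_{k_0}\ge m^{-\zeta}$; $s\mapsto s/\lambda_s$ is nonincreasing (with value $+\infty$ for $s<k_0$); $\lambda_{k+1}\le c\lambda_k$ for $k=k_0,\dots,m-1$; and $\sum_{k=s}^m\lambda_k^{-1}\le c\,s/\lambda_s$ for $s=k_0,\dots,m$. Put $\lambda_{m+1}^{-1}:=0$. Let $L=\mathrm{supp}(S_*)$ and define the coherence function $$\bar\varphi(S_*;k)=\max_{1\le t\le k}\ t\max_{t\le j\le m}\frac1j\sum_{i=1}^j\|P_L\phi_i\|^2,\quad k=1,\dots,m,\qquad \bar\varphi(S_*;m+1)=\bar\varphi(S_*;m).$$ Given $t>0$, let $t_{n,m}=t+\log\bigl(2m(\log_2(4n^{\zeta}m^{(3/2)\zeta})+2)\bigr)$, assume $m\,t_{n,m}\le n$, and set $\varepsilon=4\sqrt{\frac{t+\log(2m)}{nm}}$.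 Let $\mathbb D\subset\mathcal S_V$ be closed and convex with $S_*\in\mathbb D$ and, for $\bar\varepsilon\ge0$, let $$\hat S=\operatorname*{argmin}_{S\in\mathbb D}\Bigl[\|S\|_{L_2(\Pi^2)}^2-\frac2n\sum_{j=1}^nY_jS(X_j,X_j')+\varepsilon\|S\|_1+\bar\varepsilon\|W^{1/2}S\|_{L_2(\Pi^2)}^2\Bigr].$$ Then there exist constants $C,C_1>0$ depending only on $c$ such that, for all $s\in\{k_0+1,\dots,m+1\}$ and all $\bar\varepsilon\in[\lambda_s^{-1},\lambda_{s-1}^{-1}]$, with probability at least $1-e^{-t}$, $$\|\hat S-S_*\|_{L_2(\Pi^2)}^2\le C\,\frac{\bar\varphi(S_*;s)\,m\,t_{n,m}}{n}+\bar\varepsilon\,\|W^{1/2}S_*\|_{L_2(\Pi^2)}^2+C_1\max_{v\in V}\|P_Le_v\|^2\Bigl(\frac{m\,t_{n,m}}{n}\Bigr)^2 .$$ -/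

import Mathlib

open scoped BigOperators

/-- The linear space of symmetric kernels on `V × V` (real symmetric matrices). -/
abbrev SymKernel (V : Type*) [Fintype V] : Type _ := selfAdjoint (Matrix V V ℝ)

/-- The nuclear norm of a symmetric kernel: the sum of the absolute values of its eigenvalues
(with multiplicities). -/
noncomputable def nuclearNorm {V : Type*} [Fintype V] [DecidableEq V] (S : SymKernel V) : ℝ :=
  ∑ i, |Matrix.IsHermitian.eigenvalues (A := (S : Matrix V V ℝ)) S.2 i|

/-- The squared `L₂(Π²)`-norm of a kernel, `Π` being the uniform distribution on `V`. -/
noncomputable def l2NormSq {V : Type*} [Fintype V] (A : Matrix V V ℝ) : ℝ :=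
  (∑ u, ∑ v, |A u v| ^ 2) / (Fintype.card V : ℝ) ^ 2

open scoped MatrixOrder in
/-- The positive semidefinite square root of a (positive semidefinite) matrix. -/
noncomputable def sqrtMatrix {V : Type*} [Fintype V] [DecidableEq V] (W : Matrix V V ℝ) :
    Matrix V V ℝ :=
  CFC.sqrt W

/-- The support of a symmetric kernel: the linear span of its eigenvectors with nonzero
eigenvalues. -/
def kernelSupport {V : Type*} [Fintype V] [DecidableEq V] (S : SymKernel V) :
    Submodule ℝ (EuclideanSpace ℝ V) :=
  Submodule.span ℝ
    {ψ | ∃ σ : ℝ, σ ≠ 0 ∧ Matrix.toEuclideanLin (S : Matrix V V ℝ) ψ = σ • ψ}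

/-- `W = ∑_{k=1}^m lam k • (φ k ⊗ φ k)` with `0 ≤ lam 1 ≤ ⋯ ≤ lam m` and `φ 1, …, φ m`
orthonormal, `m` being the cardinality of `V`. Values at indices outside `1, …, m` play no role. -/
structure IsSpectralRepresentation {V : Type*} [Fintype V] (W : Matrix V V ℝ)
    (lam : ℕ → ℝ) (φ : ℕ → EuclideanSpace ℝ V) : Prop where
  orthonormal : Orthonormal ℝ (fun k : Finset.Icc 1 (Fintype.card V) => φ k)
  nonneg : ∀ k ∈ Finset.Icc 1 (Fintype.card V), 0 ≤ lam k
  mono : ∀ j ∈ Finset.Icc 1 (Fintype.card V), ∀ k ∈ Finset.Icc 1 (Fintype.card V),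
    j ≤ k → lam j ≤ lam k
  eq_sum : W = ∑ k ∈ Finset.Icc 1 (Fintype.card V), lam k • Matrix.vecMulVec (φ k) (φ k)

/-- The assumptions on the spectrum `lam 1 ≤ ⋯ ≤ lam m`: `k₀` is the index of the smallest positive
eigenvalue, `k / lam k` is nonincreasing (it is infinite for `k < k₀`), etc. -/
structure SpectrumRegular (m : ℕ) (lam : ℕ → ℝ) (k₀ : ℕ) (c ζ : ℝ) : Prop where
  isLeast : IsLeast {k | k ∈ Finset.Icc 1 m ∧ 0 < lam k} k₀
  upper : lam m ≤ (m : ℝ) ^ ζ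
  lower : (m : ℝ) ^ (-ζ) ≤ lam k₀
  antitone : ∀ j k : ℕ, k₀ ≤ j → j ≤ k → k ≤ m → (k : ℝ) / lam k ≤ (j : ℝ) / lam j
  ratio : ∀ k : ℕ, k₀ ≤ k → k + 1 ≤ m → lam (k + 1) ≤ c * lam k
  tail : ∀ s : ℕ, k₀ ≤ s → s ≤ m → ∑ k ∈ Finset.Icc s m, 1 / lam k ≤ c * (s / lam s)

/-- `(lam k)⁻¹` with the convention that it is `0` for `k > m`. -/
noncomputable def invEigenvalue (m : ℕ) (lam : ℕ → ℝ) (k : ℕ) : ℝ :=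
  if k ≤ m then (lam k)⁻¹ else 0

/-- The coherence function of a subspace `L` relative to `φ 1, …, φ m`:
`max_{1 ≤ t ≤ k} t * max_{t ≤ j ≤ m} (1 / j) ∑_{i=1}^j ‖P_L (φ i)‖²` for `1 ≤ k ≤ m`,
extended by its value at `m` for `k > m`, and equal to `0` for `k = 0`. -/
noncomputable def coherence {V : Type*} [Fintype V] (L : Submodule ℝ (EuclideanSpace ℝ V))
    (φ : ℕ → EuclideanSpace ℝ V) (k : ℕ) : ℝ :=
  sSup ((fun t : ℕ => (t : ℝ) *
      sSup ((fun j : ℕ => (1 / (j : ℝ)) * ∑ i ∈ Finset.Icc 1 j, ‖L.starProjection (φ i)‖ ^ 2) ''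
        Set.Icc t (Fintype.card V))) ''
    Set.Icc 1 (min k (Fintype.card V)))

/-- The largest squared norm `‖P_L e_v‖²` over the vectors `e_v` of the canonical basis. -/
noncomputable def maxLeverage {V : Type*} [Fintype V] [DecidableEq V]
    (L : Submodule ℝ (EuclideanSpace ℝ V)) : ℝ :=
  ⨆ v : V, ‖L.starProjection (EuclideanSpace.single v (1 : ℝ))‖ ^ 2

/-- `(X, X', Y)` is a random triple with `X, X'` independent and uniformly distributed in `V`,
`Y ∈ {-1, 1}` and `E(Y | X = u, X' = v) = S u v`. This determines the law of the triple. -/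
structure IsSimilarityTriple {V Ω : Type*} [Fintype V] [MeasurableSpace V] [MeasurableSpace Ω]
    (μ : MeasureTheory.Measure Ω) (S : SymKernel V) (X X' : Ω → V) (Y : Ω → ℝ) : Prop where
  measurable_left : Measurable X
  measurable_right : Measurable X'
  measurable_label : Measurable Y
  label : ∀ ω, Y ω = 1 ∨ Y ω = -1
  uniform_left : μ.map X = ProbabilityTheory.uniformOn (Set.univ : Set V)
  uniform_right : μ.map X' = ProbabilityTheory.uniformOn (Set.univ : Set V)
  indep : ProbabilityTheory.IndepFun X X' μ
  regression : ∀ u v : V,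
    ∫ ω, Y ω ∂(ProbabilityTheory.cond μ {ω | X ω = u ∧ X' ω = v}) = (S : Matrix V V ℝ) u v

/-- `(X j, X' j, Y j)`, `j = 1, …, n`, are independent copies of such a triple. -/
structure IsSimilaritySample {V Ω : Type*} [Fintype V] [MeasurableSpace V] [MeasurableSpace Ω]
    (μ : MeasureTheory.Measure Ω) (S : SymKernel V) {n : ℕ} (X X' : Fin n → Ω → V)
    (Y : Fin n → Ω → ℝ) : Prop where
  triple : ∀ j, IsSimilarityTriple μ S (X j) (X' j) (Y j)
  indep : ProbabilityTheory.iIndepFun (fun j ω => (X j ω, X' j ω, Y j ω)) μ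

/-- The penalized empirical risk
`‖S‖² - (2/n) ∑ⱼ yⱼ S(xⱼ, xⱼ') + ε ‖S‖₁ + ε' ‖W^{1/2} S‖²`, with `L₂(Π²)`-norms. -/
noncomputable def penalizedRisk {V : Type*} [Fintype V] [DecidableEq V] (W : Matrix V V ℝ)
    (ε ε' : ℝ) {n : ℕ} (x x' : Fin n → V) (y : Fin n → ℝ) (S : SymKernel V) : ℝ :=
  l2NormSq (S : Matrix V V ℝ)
    - 2 / (n : ℝ) * ∑ j, y j * (S : Matrix V V ℝ) (x j) (x' j)
    + ε * nuclearNorm S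
    + ε' * l2NormSq (sqrtMatrix W * (S : Matrix V V ℝ))

/-- `t_{n,m} = t + log (2m (log₂ (4 n^ζ m^{(3/2)ζ}) + 2))`. -/
noncomputable def tnm (t ζ : ℝ) (n m : ℕ) : ℝ :=
  t + Real.log (2 * m * (Real.logb 2 (4 * (n : ℝ) ^ ζ * (m : ℝ) ^ (3 / 2 * ζ)) + 2))

/-- The regularization parameter `ε = 4 √((t + log (2m)) / (n m))`. -/
noncomputable def nuclearPenalty (t : ℝ) (n m : ℕ) : ℝ :=
  4 * √((t + Real.log (2 * m)) / (n * m))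

/-! The proof separates a deterministic inequality from two tail estimates. Let S₀ be the target, Δ
the error, P the projector onto the support of S₀, and Ξ the symmetrized empirical matrix minus its
mean S₀/m².

Deterministic part (`oracle_inequality`). First-order optimality against S₀ yields a quadratic form
in Δ, and the subgradient of the nuclear norm yields a gain ε‖(1-P)Δ(1-P)‖₁. If the quadratic form
of (1-P)Ξ(1-P) is at most ε/2, this gain absorbs the noise off the support. Every remaining term
contains P and is treated by Cauchy–Schwarz in the eigenbasis of W with weights 1 + ε'λ_k. These
weights reproduce the quadratic form in Δ, which is absorbed on the left. What is left is the bias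
ε'‖W^{1/2}S₀‖², the weighted noise Σ‖ΞPφ_k‖²/(1+ε'λ_k), and ε²Q with Q = Σ‖Pφ_k‖²/(1+ε'λ_k).

Spectral part. Since ε' ≥ 1/λ_s, the weights of Q decay like λ_s/λ_k beyond s. Summation by parts
against the coherence bounds and the tail condition on the spectrum give Q ≤ (1+c)φ̄(S₀;s)
(`sum_projection_div_le_coherence`).

Probabilistic part. The observations take finitely many values, so probabilities are finite sums of
products. Golden–Thompson peels off one observation at a time (the Ahlswede–Winter argument) and
gives `matrix_bernstein`. Applied to Ξ it yields the ε/2 condition (`noise_operator_tail`). The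
weighted noise is the squared norm of one random vector, with variance of order Q/m and size
governed by the maximal leverage, so `vector_bernstein` bounds it (`noise_support_tail`). The two
exceptional events use 3/4 and 1/4 of the probability e^{-t}. -/

/-! ### The Lie product formula and the Golden–Thompson inequality. -/

section GoldenThompson

open Filter Topology

theorem norm_exp_le_exp_norm {𝔸 : Type*} [NormedRing 𝔸] [NormedAlgebra ℝ 𝔸] [CompleteSpace 𝔸]
    [NormOneClass 𝔸] (x : 𝔸) : ‖NormedSpace.exp x‖ ≤ Real.exp ‖x‖ := by
  have h1 := NormedSpace.exp_series_hasSum_exp' (𝕂 := ℝ) x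
  have h2 := NormedSpace.exp_series_hasSum_exp' (𝕂 := ℝ) ‖x‖
  rw [← Real.exp_eq_exp_ℝ] at h2
  refine h1.norm_le_of_bounded h2 fun i => ?_
  rw [norm_smul, smul_eq_mul, Real.norm_of_nonneg (by positivity)]
  gcongr
  exact norm_pow_le x i

theorem norm_pow_sub_pow_le {𝔸 : Type*} [NormedRing 𝔸] [NormOneClass 𝔸] (x y : 𝔸) {r : ℝ}
    (hx : ‖x‖ ≤ r) (hy : ‖y‖ ≤ r) (N : ℕ) :
    ‖x ^ (N + 1) - y ^ (N + 1)‖ ≤ (N + 1) * (r ^ N * ‖x - y‖) := by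
  have hr : 0 ≤ r := (norm_nonneg x).trans hx
  induction N with
  | zero => simp
  | succ N ih =>
    have h : x ^ (N + 1 + 1) - y ^ (N + 1 + 1)
        = x ^ (N + 1) * (x - y) + (x ^ (N + 1) - y ^ (N + 1)) * y := by
      rw [pow_succ x (N + 1), pow_succ y (N + 1)]; noncomm_ring
    have h1 : ‖x ^ (N + 1) * (x - y)‖ ≤ r ^ (N + 1) * ‖x - y‖ := by
      refine (norm_mul_le _ _).trans ?_
      gcongr
      exact (norm_pow_le _ _).trans (by gcongr)
    have h2 : ‖(x ^ (N + 1) - y ^ (N + 1)) * y‖ ≤ ((N + 1) * (r ^ N * ‖x - y‖)) * r := by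
      refine (norm_mul_le _ _).trans ?_
      gcongr
    rw [h]
    refine (norm_add_le _ _).trans ((add_le_add h1 h2).trans (le_of_eq ?_))
    push_cast
    ring

/-- The Lie product formula. -/
theorem tendsto_exp_mul_exp_pow {𝔸 : Type*} [NormedRing 𝔸] [NormedAlgebra ℝ 𝔸] [CompleteSpace 𝔸]
    [NormOneClass 𝔸] (A B : 𝔸) :
    Tendsto (fun N : ℕ => (NormedSpace.exp ((N + 1 : ℝ)⁻¹ • A)
      * NormedSpace.exp ((N + 1 : ℝ)⁻¹ • B)) ^ (N + 1)) atTop (𝓝 (NormedSpace.exp (A + B))) := by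
  let _ : NormedAlgebra ℚ 𝔸 := NormedAlgebra.restrictScalars ℚ ℝ 𝔸
  set g : ℝ → 𝔸 := fun s => NormedSpace.exp (s • A) * NormedSpace.exp (s • B)
    - NormedSpace.exp (s • (A + B)) with hg
  have hg0 : g 0 = 0 := by simp [hg]
  have hderiv : HasDerivAt g 0 0 := by
    have h := ((hasDerivAt_exp_smul_const (𝕂 := ℝ) A (0 : ℝ)).mul
      (hasDerivAt_exp_smul_const (𝕂 := ℝ) B (0 : ℝ))).sub
      (hasDerivAt_exp_smul_const (𝕂 := ℝ) (A + B) (0 : ℝ))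
    refine HasDerivAt.congr_deriv (f := g) h ?_
    simp
  -- `g` vanishes to first order at 0, so g(1/(N+1)) = o(1/(N+1)); this beats the factor N + 1 lost
  -- when powers are compared by telescoping.
  have hlim : Tendsto (fun N : ℕ => ((N : ℝ) + 1) * ‖g ((N + 1 : ℝ)⁻¹)‖) atTop (𝓝 0) := by
    have h1 := hasDerivAt_iff_tendsto_slope.1 hderiv
    have h2 : Tendsto (fun N : ℕ => ((N : ℝ) + 1)⁻¹) atTop (𝓝[≠] 0) := by
      refine tendsto_nhdsWithin_iff.2 ⟨?_, Eventually.of_forall fun N => ?_⟩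
      · simpa using tendsto_one_div_add_atTop_nhds_zero_nat (𝕜 := ℝ)
      · have : (0 : ℝ) < N + 1 := by positivity
        simpa using this.ne'
    have h3 := (h1.comp h2).norm
    simp only [norm_zero] at h3
    refine h3.congr fun N => ?_
    have : (0 : ℝ) < N + 1 := by positivity
    simp only [Function.comp, slope, hg0, vsub_eq_sub, sub_zero, inv_inv, norm_smul]
    rw [Real.norm_of_nonneg this.le]
  set K := Real.exp (‖A‖ + ‖B‖)
  rw [tendsto_iff_norm_sub_tendsto_zero]
  refine squeeze_zero (fun _ => norm_nonneg _) (fun N => ?_)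
    (by simpa using hlim.const_mul K)
  have hN : (0 : ℝ) < N + 1 := by positivity
  have he : NormedSpace.exp (A + B) = NormedSpace.exp ((N + 1 : ℝ)⁻¹ • (A + B)) ^ (N + 1) := by
    rw [← NormedSpace.exp_nsmul, ← Nat.cast_smul_eq_nsmul ℝ, smul_smul]
    push_cast
    rw [mul_inv_cancel₀ hN.ne', one_smul]
  have hsm : ∀ C : 𝔸, ‖(N + 1 : ℝ)⁻¹ • C‖ = (N + 1 : ℝ)⁻¹ * ‖C‖ := fun C => by
    rw [norm_smul, Real.norm_of_nonneg (by positivity)]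
  have hx : ‖NormedSpace.exp ((N + 1 : ℝ)⁻¹ • A) * NormedSpace.exp ((N + 1 : ℝ)⁻¹ • B)‖
      ≤ Real.exp ((N + 1 : ℝ)⁻¹ * (‖A‖ + ‖B‖)) := by
    refine (norm_mul_le _ _).trans ?_
    rw [mul_add, Real.exp_add, ← hsm, ← hsm]
    gcongr <;> exact norm_exp_le_exp_norm _
  have hy : ‖NormedSpace.exp ((N + 1 : ℝ)⁻¹ • (A + B))‖
      ≤ Real.exp ((N + 1 : ℝ)⁻¹ * (‖A‖ + ‖B‖)) := by
    refine (norm_exp_le_exp_norm _).trans (Real.exp_le_exp.2 ?_)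
    rw [hsm]
    gcongr
    exact norm_add_le _ _
  rw [he]
  refine (norm_pow_sub_pow_le _ _ hx hy N).trans ?_
  have hK : Real.exp ((N + 1 : ℝ)⁻¹ * (‖A‖ + ‖B‖)) ^ N ≤ K := by
    rw [← Real.exp_nat_mul]
    refine Real.exp_le_exp.2 ?_
    rw [← mul_assoc]
    refine mul_le_of_le_one_left (by positivity) ?_
    rw [← div_eq_mul_inv, div_le_one hN]
    linarith
  calc ((N : ℝ) + 1) * (Real.exp ((N + 1 : ℝ)⁻¹ * (‖A‖ + ‖B‖)) ^ N * ‖g ((N + 1 : ℝ)⁻¹)‖)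
      ≤ ((N : ℝ) + 1) * (K * ‖g ((N + 1 : ℝ)⁻¹)‖) := by gcongr
    _ = K * (((N : ℝ) + 1) * ‖g ((N + 1 : ℝ)⁻¹)‖) := by ring

namespace Matrix

variable {ι : Type*} [Fintype ι]

theorem trace_mul_transpose_self_nonneg (A : Matrix ι ι ℝ) : 0 ≤ (A * Aᵀ).trace := by
  simp only [trace, diag_apply, mul_apply, transpose_apply]
  exact Finset.sum_nonneg fun i _ => Finset.sum_nonneg fun j _ => mul_self_nonneg _

theorem trace_mul_le_sqrt (A B : Matrix ι ι ℝ) :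
    (A * B).trace ≤ √((A * Aᵀ).trace * (B * Bᵀ).trace) := by
  refine Real.le_sqrt_of_sq_le ?_
  have h := Finset.sum_mul_sq_le_sq_mul_sq (Finset.univ : Finset (ι × ι))
    (fun x => A x.1 x.2) (fun x => B x.2 x.1)
  rw [Fintype.sum_prod_type, Fintype.sum_prod_type, Fintype.sum_prod_type] at h
  simp only [trace, diag_apply, mul_apply, transpose_apply]
  refine h.trans (le_of_eq ?_)
  rw [Finset.sum_comm (f := fun i j => B j i ^ 2)]
  simp only [sq]

variable [DecidableEq ι]

theorem trace_mul_pow_comm (A B : Matrix ι ι ℝ) (N : ℕ) :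
    ((A * B) ^ N).trace = ((B * A) ^ N).trace := by
  cases N with
  | zero => simp
  | succ N =>
    rw [pow_succ, ← mul_assoc, mul_pow_mul, mul_assoc, trace_mul_comm, mul_assoc, ← pow_succ]

/-- The two halves feed each other. For the first, its previous case at M² leads cyclically to the
product of MᵀM and MMᵀ, and the second half applies; both factors have the same power traces, so the
square root disappears. For the second, the first half at PQ leads cyclically to P²Q². -/
theorem trace_pow_two_pow_le (k : ℕ) :
    (∀ M : Matrix ι ι ℝ, (M ^ 2 ^ (k + 1)).trace ≤ ((M * Mᵀ) ^ 2 ^ k).trace) ∧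
    (∀ P Q : Matrix ι ι ℝ, Pᵀ = P → Qᵀ = Q →
      ((P * Q) ^ 2 ^ k).trace ≤ √((P ^ 2 ^ (k + 1)).trace * (Q ^ 2 ^ (k + 1)).trace)) := by
  induction k with
  | zero =>
    constructor
    · intro M
      have h := trace_mul_le_sqrt M M
      rw [Real.sqrt_mul_self (trace_mul_transpose_self_nonneg M)] at h
      simpa [sq] using h
    · intro P Q hP hQ
      have h := trace_mul_le_sqrt P Q
      rw [hP, hQ] at h
      simpa [sq] using h
  | succ k ih =>
    obtain ⟨ihM, ihP⟩ := ih
    constructor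
    · intro M
      have h1 := ihM (M ^ 2)
      have h2 := ihP (Mᵀ * M) (M * Mᵀ) (by simp) (by simp)
      have h3 : M ^ 2 * (M ^ 2)ᵀ = (M * (M * Mᵀ)) * Mᵀ := by
        rw [transpose_pow, sq, sq]; simp only [mul_assoc]
      have h0 : 0 ≤ ((M * Mᵀ) ^ 2 ^ (k + 1)).trace := by
        have := trace_mul_transpose_self_nonneg ((M * Mᵀ) ^ 2 ^ k)
        rw [transpose_pow, transpose_mul, transpose_transpose, ← pow_add] at this
        convert this using 3
        ring
      rw [← pow_mul, h3, trace_mul_pow_comm, ← mul_assoc] at h1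
      rw [trace_mul_pow_comm Mᵀ M, Real.sqrt_mul_self h0] at h2
      rw [pow_succ' 2 (k + 1)]
      exact h1.trans h2
    · intro P Q hP hQ
      have h1 := ihM (P * Q)
      have h2 := ihP (P ^ 2) (Q ^ 2) (by rw [transpose_pow, hP]) (by rw [transpose_pow, hQ])
      rw [transpose_mul, hP, hQ, ← mul_assoc, trace_mul_pow_comm (P * Q * Q) P, mul_assoc P Q Q, ← mul_assoc,
        ← sq, ← sq] at h1
      rw [← pow_mul, ← pow_mul, ← pow_succ'] at h2
      exact h1.trans h2

/-- Each halving of the exponent replaces X, Y by X², Y²: the trace of (XY)^(2^(k+1)) is at most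
that of (XYYX)^(2^k), which is cyclically (X²Y²)^(2^k). -/
theorem trace_mul_pow_two_pow_le (k : ℕ) :
    ∀ X Y : Matrix ι ι ℝ, Xᵀ = X → Yᵀ = Y →
      ((X * Y) ^ 2 ^ k).trace ≤ (X ^ 2 ^ k * Y ^ 2 ^ k).trace := by
  induction k with
  | zero => intro X Y _ _; simp
  | succ k ih =>
    intro X Y hX hY
    have h1 := (trace_pow_two_pow_le k).1 (X * Y)
    have h2 := ih (X ^ 2) (Y ^ 2) (by rw [transpose_pow, hX]) (by rw [transpose_pow, hY])
    rw [transpose_mul, hX, hY, ← mul_assoc, trace_mul_pow_comm (X * Y * Y) X, mul_assoc X Y Y, ← mul_assoc,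
      ← sq, ← sq] at h1
    rw [← pow_mul, ← pow_mul, ← pow_succ'] at h2
    exact h1.trans h2

open scoped Matrix.Norms.L2Operator in
/-- The **Golden–Thompson inequality** for real symmetric matrices. -/
theorem trace_exp_add_le {A B : Matrix ι ι ℝ} (hA : A.IsHermitian) (hB : B.IsHermitian) :
    (NormedSpace.exp (A + B)).trace ≤ (NormedSpace.exp A * NormedSpace.exp B).trace := by
  cases isEmpty_or_nonempty ι
  · simp [trace]
  have hA' : Aᵀ = A := by simpa [IsHermitian] using hA
  have hB' : Bᵀ = B := by simpa [IsHermitian] using hB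
  have hlim := tendsto_exp_mul_exp_pow A B
  -- The trace inequality is available for exponents 2^k only, so the Lie limit is taken along N + 1
  -- = 2^k.
  have hsub : Tendsto (fun k : ℕ => 2 ^ k - 1) atTop atTop := by
    refine tendsto_atTop_mono (fun k => ?_) tendsto_id
    have := Nat.lt_two_pow_self (n := k)
    simp only [id]; omega
  have htr : Continuous (trace : Matrix ι ι ℝ → ℝ) := continuous_id.matrix_trace
  have hlim' := (htr.tendsto _).comp (hlim.comp hsub)
  refine le_of_tendsto hlim' (Eventually.of_forall fun k => ?_)
  have h2k : 2 ^ k - 1 + 1 = 2 ^ k := Nat.sub_add_cancel Nat.one_le_two_pow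
  have hcast : (((2 ^ k - 1 : ℕ) : ℝ) + 1) = ((2 ^ k : ℕ) : ℝ) := by exact_mod_cast h2k
  have hexp : ∀ C : Matrix ι ι ℝ,
      NormedSpace.exp (((2 ^ k : ℕ) : ℝ)⁻¹ • C) ^ 2 ^ k = NormedSpace.exp C := by
    intro C
    rw [← Matrix.exp_nsmul, ← Nat.cast_smul_eq_nsmul ℝ, smul_smul, mul_inv_cancel₀ (by positivity),
      one_smul]
  simp only [Function.comp, h2k, hcast]
  refine (trace_mul_pow_two_pow_le k _ _ ?_ ?_).trans (le_of_eq ?_)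
  · rw [← exp_transpose, transpose_smul, hA']
  · rw [← exp_transpose, transpose_smul, hB']
  · rw [hexp, hexp]

end Matrix

end GoldenThompson

/-! ### Functions of a real symmetric matrix through its eigenvectors. -/

section SpectralCalculus

namespace Matrix.IsHermitian

open Matrix

variable {ι : Type*} [Fintype ι] [DecidableEq ι] {A : Matrix ι ι ℝ} (hA : A.IsHermitian)

/-- The orthogonal matrix whose columns are the eigenvectors of `A`. -/
noncomputable def eigenMatrix : Matrix ι ι ℝ := (hA.eigenvectorUnitary : Matrix ι ι ℝ)

theorem eigenMatrix_mul_transpose : hA.eigenMatrix * hA.eigenMatrixᵀ = 1 := by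
  have h := Unitary.coe_mul_star_self hA.eigenvectorUnitary
  simpa [star_eq_conjTranspose, eigenMatrix] using h

theorem transpose_mul_eigenMatrix : hA.eigenMatrixᵀ * hA.eigenMatrix = 1 := by
  have h := Unitary.coe_star_mul_self hA.eigenvectorUnitary
  simpa [star_eq_conjTranspose, eigenMatrix] using h

theorem eigenMatrix_transpose_apply (i : ι) : hA.eigenMatrixᵀ i = hA.eigenvectorBasis i :=
  hA.eigenvectorUnitary_transpose_apply i

/-- The function `f` applied to the symmetric matrix `A` through its eigenvalues. -/
noncomputable def funCalc (f : ℝ → ℝ) : Matrix ι ι ℝ :=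
  hA.eigenMatrix * diagonal (fun i => f (hA.eigenvalues i)) * hA.eigenMatrixᵀ

theorem funCalc_id : hA.funCalc (fun x => x) = A := by
  have h := hA.spectral_theorem
  rw [Unitary.conjStarAlgAut_apply] at h
  have hs : star (hA.eigenvectorUnitary : Matrix ι ι ℝ) = hA.eigenMatrixᵀ := by
    simp [star_eq_conjTranspose, eigenMatrix]
  rw [hs] at h
  exact h.symm

theorem funCalc_one : hA.funCalc (fun _ => 1) = 1 := by
  rw [funCalc, diagonal_one, mul_one, eigenMatrix_mul_transpose]

theorem funCalc_mul (f g : ℝ → ℝ) :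
    hA.funCalc f * hA.funCalc g = hA.funCalc (fun x => f x * g x) := by
  have h : hA.funCalc f * hA.funCalc g = hA.eigenMatrix * diagonal (fun i => f (hA.eigenvalues i))
      * (hA.eigenMatrixᵀ * hA.eigenMatrix) * diagonal (fun i => g (hA.eigenvalues i))
      * hA.eigenMatrixᵀ := by simp only [funCalc, mul_assoc]
  rw [h, transpose_mul_eigenMatrix, mul_one, mul_assoc hA.eigenMatrix, diagonal_mul_diagonal]
  rfl

theorem funCalc_transpose (f : ℝ → ℝ) : (hA.funCalc f)ᵀ = hA.funCalc f := by
  simp only [funCalc, transpose_mul, transpose_transpose, diagonal_transpose, mul_assoc]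

theorem exp_smul_eq_funCalc (θ : ℝ) :
    NormedSpace.exp (θ • A) = hA.funCalc (fun x => Real.exp (θ * x)) := by
  have hinv : hA.eigenMatrix⁻¹ = hA.eigenMatrixᵀ := inv_eq_right_inv hA.eigenMatrix_mul_transpose
  have hunit : IsUnit hA.eigenMatrix :=
    IsUnit.of_mul_eq_one _ hA.eigenMatrix_mul_transpose
  have h1 : θ • A = hA.eigenMatrix * diagonal (fun i => θ * hA.eigenvalues i)
      * hA.eigenMatrix⁻¹ := by
    conv_lhs => rw [← hA.funCalc_id]
    rw [hinv, funCalc, ← smul_mul_assoc, ← mul_smul_comm, ← diagonal_smul]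
    rfl
  rw [h1, exp_conj _ _ hunit, exp_diagonal, hinv, funCalc]
  congr 2
  ext i
  simp [Pi.exp_def, Real.exp_eq_exp_ℝ]

theorem trace_funCalc_mul (f : ℝ → ℝ) (N : Matrix ι ι ℝ) :
    (hA.funCalc f * N).trace
      = ∑ i, f (hA.eigenvalues i) * (hA.eigenMatrixᵀ i ⬝ᵥ N *ᵥ hA.eigenMatrixᵀ i) := by
  rw [funCalc, mul_assoc, mul_assoc, trace_mul_comm, mul_assoc, trace]
  refine Finset.sum_congr rfl fun i _ => ?_
  rw [diag_apply, diagonal_mul, mul_assoc, mul_apply']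
  rfl

theorem trace_funCalc (f : ℝ → ℝ) : (hA.funCalc f).trace = ∑ i, f (hA.eigenvalues i) := by
  rw [funCalc, trace_mul_comm, ← mul_assoc, transpose_mul_eigenMatrix, one_mul, trace_diagonal]

theorem eigenMatrix_dotProduct_self (i : ι) :
    hA.eigenMatrixᵀ i ⬝ᵥ hA.eigenMatrixᵀ i = 1 := by
  have h := congrFun (congrFun hA.transpose_mul_eigenMatrix i) i
  rw [mul_apply', one_apply_eq] at h
  exact h

theorem dotProduct_funCalc_mulVec (f : ℝ → ℝ) (w : ι → ℝ) :
    w ⬝ᵥ hA.funCalc f *ᵥ w = ∑ i, f (hA.eigenvalues i) * (hA.eigenMatrixᵀ *ᵥ w) i ^ 2 := by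
  rw [funCalc, mul_assoc, ← mulVec_mulVec, ← mulVec_mulVec, dotProduct_mulVec, ← mulVec_transpose]
  simp only [dotProduct, mulVec_diagonal]
  exact Finset.sum_congr rfl fun i _ => by ring

theorem dotProduct_self_eq_sum (w : ι → ℝ) :
    w ⬝ᵥ w = ∑ i, (hA.eigenMatrixᵀ *ᵥ w) i ^ 2 := by
  have h := hA.dotProduct_funCalc_mulVec (fun _ => 1) w
  rw [funCalc_one, one_mulVec] at h
  simpa using h

theorem dotProduct_mulVec_eq_sum (w : ι → ℝ) :
    w ⬝ᵥ A *ᵥ w = ∑ i, hA.eigenvalues i * (hA.eigenMatrixᵀ *ᵥ w) i ^ 2 := by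
  have h := hA.dotProduct_funCalc_mulVec (fun x => x) w
  rwa [funCalc_id] at h

theorem mulVec_dotProduct_mulVec {ι : Type*} [Fintype ι] {A : Matrix ι ι ℝ} (hA : A.IsHermitian)
    (w z : ι → ℝ) : (A *ᵥ w) ⬝ᵥ z = w ⬝ᵥ A *ᵥ z := by
  have hT : Aᵀ = A := by simpa [IsHermitian] using hA
  rw [dotProduct_mulVec, ← mulVec_transpose, hT]

theorem mulVec_dotProduct_self_eq_sum (w : ι → ℝ) :
    (A *ᵥ w) ⬝ᵥ (A *ᵥ w) = ∑ i, hA.eigenvalues i ^ 2 * (hA.eigenMatrixᵀ *ᵥ w) i ^ 2 := by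
  have h := hA.dotProduct_funCalc_mulVec (fun x => x * x) w
  rw [← funCalc_mul, funCalc_id, ← mulVec_mulVec] at h
  rw [hA.mulVec_dotProduct_mulVec, h]
  simp only [sq]

theorem eigenvalues_eq_dotProduct (i : ι) :
    hA.eigenvalues i = hA.eigenMatrixᵀ i ⬝ᵥ A *ᵥ hA.eigenMatrixᵀ i := by
  have h : A *ᵥ hA.eigenMatrixᵀ i = hA.eigenvalues i • hA.eigenMatrixᵀ i := by
    rw [eigenMatrix_transpose_apply]
    exact hA.mulVec_eigenvectorBasis i
  rw [h, dotProduct_smul, eigenMatrix_dotProduct_self, smul_eq_mul, mul_one]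

theorem abs_eigenvalues_le {K : ℝ} (h : ∀ w, |w ⬝ᵥ A *ᵥ w| ≤ K * (w ⬝ᵥ w)) (i : ι) :
    |hA.eigenvalues i| ≤ K := by
  have h1 := h (hA.eigenMatrixᵀ i)
  rwa [← eigenvalues_eq_dotProduct, eigenMatrix_dotProduct_self, mul_one] at h1

/-- In an eigenbasis of `A` only the diagonal entries of `N` count, and they carry positive weights.
A one-sided bound on the quadratic form therefore suffices, with no symmetry of `N`. -/
theorem trace_exp_mul_le {A : Matrix ι ι ℝ} (hA : A.IsHermitian) {N : Matrix ι ι ℝ} {ρ : ℝ}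
    (h : ∀ w, w ⬝ᵥ N *ᵥ w ≤ ρ * (w ⬝ᵥ w)) :
    (NormedSpace.exp A * N).trace ≤ ρ * (NormedSpace.exp A).trace := by
  have he := hA.exp_smul_eq_funCalc 1
  rw [one_smul] at he
  rw [he, trace_funCalc_mul, trace_funCalc, Finset.mul_sum]
  refine Finset.sum_le_sum fun i _ => ?_
  have h1 := h (hA.eigenMatrixᵀ i)
  rw [eigenMatrix_dotProduct_self, mul_one] at h1
  rw [mul_comm ρ]
  gcongr

end Matrix.IsHermitian

end SpectralCalculus

/-! ### Matrix Bernstein inequality over a finite sample space. -/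

section MatrixBernstein

open Matrix

/-- The function (1+y+y²)e^{-y} has derivative (y-y²)e^{-y}: on (-∞,1] its minimum is the value 1 at
0, and it decreases afterwards, so only the endpoint 3/2 needs a numerical check. The range up to
3/2 accommodates noise matrices of size 1 + 1/m with m ≥ 2. -/
theorem exp_le_one_add_add_sq {x : ℝ} (hx : x ≤ 3 / 2) : Real.exp x ≤ 1 + x + x ^ 2 := by
  set g : ℝ → ℝ := fun y => (1 + y + y ^ 2) * Real.exp (-y) with hg
  have hd : ∀ y, HasDerivAt g ((y - y ^ 2) * Real.exp (-y)) y := by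
    intro y
    have h1 : HasDerivAt (fun y : ℝ => 1 + y + y ^ 2) (1 + 2 * y) y := by
      have := ((hasDerivAt_const y (1 : ℝ)).add (hasDerivAt_id y)).add (hasDerivAt_pow 2 y)
      refine HasDerivAt.congr_deriv this ?_
      simp
    have h2 : HasDerivAt (fun y : ℝ => Real.exp (-y)) (Real.exp (-y) * (-1)) y :=
      (hasDerivAt_neg y).exp
    refine (h1.mul h2).congr_deriv ?_
    ring
  have hcont : Continuous g := by fun_prop
  suffices h : 1 ≤ g x by
    simp only [hg] at h
    calc Real.exp x = 1 * Real.exp x := (one_mul _).symm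
      _ ≤ ((1 + x + x ^ 2) * Real.exp (-x)) * Real.exp x := by gcongr
      _ = 1 + x + x ^ 2 := by rw [mul_assoc, ← Real.exp_add]; simp
  have hg0 : g 0 = 1 := by simp [hg]
  rcases le_total x 0 with h0 | h0
  · have hanti : AntitoneOn g (Set.Iic 0) := by
      refine antitoneOn_of_deriv_nonpos (convex_Iic 0) hcont.continuousOn
        (fun y _ => (hd y).differentiableAt.differentiableWithinAt) fun y hy => ?_
      rw [interior_Iic] at hy
      rw [(hd y).deriv]
      have hy' : y < 0 := hy
      exact mul_nonpos_of_nonpos_of_nonneg (by nlinarith) (Real.exp_nonneg _)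
    rw [← hg0]
    exact hanti h0 (Set.self_mem_Iic) h0
  · rcases le_total x 1 with h1 | h1
    · have hmono : MonotoneOn g (Set.Icc 0 1) := by
        refine monotoneOn_of_deriv_nonneg (convex_Icc 0 1) hcont.continuousOn
          (fun y _ => (hd y).differentiableAt.differentiableWithinAt) fun y hy => ?_
        rw [interior_Icc] at hy
        rw [(hd y).deriv]
        exact mul_nonneg (by nlinarith [hy.1, hy.2]) (Real.exp_nonneg _)
      rw [← hg0]
      exact hmono (by simp) ⟨h0, h1⟩ h0
    · have hanti : AntitoneOn g (Set.Ici 1) := by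
        refine antitoneOn_of_deriv_nonpos (convex_Ici 1) hcont.continuousOn
          (fun y _ => (hd y).differentiableAt.differentiableWithinAt) fun y hy => ?_
        rw [interior_Ici] at hy
        rw [(hd y).deriv]
        have hy' : 1 < y := hy
        exact mul_nonpos_of_nonpos_of_nonneg (by nlinarith) (Real.exp_nonneg _)
      have h3 : 1 ≤ g (3 / 2) := by
        have he : Real.exp (3 / 2) ≤ 19 / 4 := by
          have h4 : Real.exp (3 / 2) ^ 2 = Real.exp 1 ^ 3 := by
            rw [← Real.exp_nat_mul, ← Real.exp_nat_mul]; norm_num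
          have h5 : Real.exp 1 ^ 3 ≤ 2.7182818286 ^ 3 :=
            pow_le_pow_left₀ (Real.exp_nonneg _) Real.exp_one_lt_d9.le 3
          refine le_of_sq_le_sq ?_ (by norm_num)
          rw [h4]
          exact h5.trans (by norm_num)
        simp only [hg, Real.exp_neg]
        rw [← div_eq_mul_inv, le_div_iff₀ (Real.exp_pos _)]
        linarith
      exact h3.trans (hanti (Set.mem_Ici.2 h1) (Set.mem_Ici.2 (by norm_num)) hx)

variable {ι T : Type*} [Fintype ι] [DecidableEq ι] [Fintype T]

theorem Matrix.IsHermitian.dotProduct_exp_mulVec_le {A : Matrix ι ι ℝ} (hA : A.IsHermitian)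
    {U θ : ℝ} (hU : ∀ w, |w ⬝ᵥ A *ᵥ w| ≤ U * (w ⬝ᵥ w)) (hθ : 0 ≤ θ) (hθU : θ * U ≤ 3 / 2)
    (w : ι → ℝ) :
    w ⬝ᵥ NormedSpace.exp (θ • A) *ᵥ w
      ≤ w ⬝ᵥ w + θ * (w ⬝ᵥ A *ᵥ w) + θ ^ 2 * ((A *ᵥ w) ⬝ᵥ (A *ᵥ w)) := by
  rw [hA.exp_smul_eq_funCalc, hA.dotProduct_funCalc_mulVec, hA.dotProduct_self_eq_sum,
    hA.dotProduct_mulVec_eq_sum, hA.mulVec_dotProduct_self_eq_sum, Finset.mul_sum, Finset.mul_sum,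
    ← Finset.sum_add_distrib, ← Finset.sum_add_distrib]
  refine Finset.sum_le_sum fun i _ => ?_
  have h1 : hA.eigenvalues i ≤ U := (le_abs_self _).trans (hA.abs_eigenvalues_le hU i)
  have h2 := exp_le_one_add_add_sq ((mul_le_mul_of_nonneg_left h1 hθ).trans hθU)
  nlinarith [mul_le_mul_of_nonneg_right h2 (sq_nonneg ((hA.eigenMatrixᵀ *ᵥ w) i))]

/-- Generalizing over `H` makes the induction work: the first observation is added to `H`, the
others are averaged by the induction hypothesis, and Golden–Thompson then splits the first one off.
Its average contributes one factor ρ. -/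
theorem sum_prod_mul_trace_exp_le (p : T → ℝ) (hp : ∀ τ, 0 ≤ p τ) (A : T → Matrix ι ι ℝ)
    (hA : ∀ τ, (A τ).IsHermitian) {ρ : ℝ} (hρ0 : 0 ≤ ρ)
    (hρ : ∀ w, ∑ τ, p τ * (w ⬝ᵥ NormedSpace.exp (A τ) *ᵥ w) ≤ ρ * (w ⬝ᵥ w)) (n : ℕ) :
    ∀ H : Matrix ι ι ℝ, H.IsHermitian →
      ∑ z : Fin n → T, (∏ j, p (z j)) * (NormedSpace.exp (H + ∑ j, A (z j))).trace
        ≤ ρ ^ n * (NormedSpace.exp H).trace := by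
  induction n with
  | zero => intro H _; simp
  | succ n ih =>
    intro H hH
    rw [← (Fin.consEquiv (fun _ => T)).sum_comp, Fintype.sum_prod_type]
    have h1 : ∀ τ, ∑ z : Fin n → T, (∏ j, p (Fin.consEquiv (fun _ => T) (τ, z) j))
        * (NormedSpace.exp (H + ∑ j, A (Fin.consEquiv (fun _ => T) (τ, z) j))).trace
        ≤ p τ * (ρ ^ n * (NormedSpace.exp H * NormedSpace.exp (A τ)).trace) := by
      intro τ
      have h2 := ih (H + A τ) (hH.add (hA τ))
      have h3 := mul_le_mul_of_nonneg_left (trace_exp_add_le hH (hA τ)) (pow_nonneg hρ0 n)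
      refine le_trans (le_of_eq ?_) (mul_le_mul_of_nonneg_left (h2.trans h3) (hp τ))
      rw [Finset.mul_sum]
      refine Finset.sum_congr rfl fun z _ => ?_
      simp only [Fin.consEquiv_apply, Fin.prod_univ_succ, Fin.sum_univ_succ, Fin.cons_zero,
        Fin.cons_succ, add_assoc, mul_assoc]
    refine (Finset.sum_le_sum fun τ _ => h1 τ).trans ?_
    have h4 : ∑ τ, p τ * (ρ ^ n * (NormedSpace.exp H * NormedSpace.exp (A τ)).trace)
        = ρ ^ n * (NormedSpace.exp H * ∑ τ, p τ • NormedSpace.exp (A τ)).trace := by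
      rw [Finset.mul_sum, trace_sum, Finset.mul_sum]
      refine Finset.sum_congr rfl fun τ _ => ?_
      rw [mul_smul_comm, trace_smul, smul_eq_mul]
      ring
    rw [h4, pow_succ, mul_assoc]
    refine mul_le_mul_of_nonneg_left (hH.trace_exp_mul_le fun w => ?_) (pow_nonneg hρ0 n)
    refine le_trans (le_of_eq ?_) (hρ w)
    rw [sum_mulVec, dotProduct_sum]
    exact Finset.sum_congr rfl fun τ _ => by rw [smul_mulVec, dotProduct_smul, smul_eq_mul]

/-- A **matrix Bernstein inequality**, in Laplace transform form, for the largest eigenvalue of a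
sum of independent copies of a finitely valued centered random symmetric matrix. -/
theorem matrix_bernstein [DecidableEq T] (p : T → ℝ) (hp : ∀ τ, 0 ≤ p τ) (hp1 : ∑ τ, p τ = 1)
    (A : T → Matrix ι ι ℝ) (hA : ∀ τ, (A τ).IsHermitian) (hmean : ∑ τ, p τ • A τ = 0)
    {U θ σ x : ℝ} (hU : ∀ τ w, |w ⬝ᵥ A τ *ᵥ w| ≤ U * (w ⬝ᵥ w)) (hθ : 0 ≤ θ)
    (hθU : θ * U ≤ 3 / 2)
    (hσ : ∀ w, ∑ τ, p τ * ((A τ *ᵥ w) ⬝ᵥ (A τ *ᵥ w)) ≤ σ * (w ⬝ᵥ w)) (n : ℕ)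
    (B : Finset (Fin n → T)) (hB : ∀ z ∈ B, ∃ w, x * (w ⬝ᵥ w) < w ⬝ᵥ (∑ j, A (z j)) *ᵥ w) :
    ∑ z ∈ B, ∏ j, p (z j) ≤ Fintype.card ι * Real.exp (n * (θ ^ 2 * σ) - θ * x) := by
  have hherm : ∀ z : Fin n → T, (∑ j, A (z j)).IsHermitian := fun z => by
    have : ∀ s : Finset (Fin n), (∑ j ∈ s, A (z j)).IsHermitian := fun s => by
      rw [IsHermitian, conjTranspose_sum]
      exact Finset.sum_congr rfl fun j _ => hA _
    exact this _
  have hρ : ∀ w, ∑ τ, p τ * (w ⬝ᵥ NormedSpace.exp (θ • A τ) *ᵥ w)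
      ≤ Real.exp (θ ^ 2 * σ) * (w ⬝ᵥ w) := by
    intro w
    have hw : 0 ≤ w ⬝ᵥ w := Finset.sum_nonneg fun _ _ => mul_self_nonneg _
    have h1 : ∑ τ, p τ * (w ⬝ᵥ A τ *ᵥ w) = 0 := by
      have h := congrArg (fun M : Matrix ι ι ℝ => w ⬝ᵥ M *ᵥ w) hmean
      simp only [sum_mulVec, dotProduct_sum, smul_mulVec, dotProduct_smul, smul_eq_mul,
        zero_mulVec, dotProduct_zero] at h
      exact h
    calc ∑ τ, p τ * (w ⬝ᵥ NormedSpace.exp (θ • A τ) *ᵥ w)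
        ≤ ∑ τ, p τ * (w ⬝ᵥ w + θ * (w ⬝ᵥ A τ *ᵥ w)
            + θ ^ 2 * ((A τ *ᵥ w) ⬝ᵥ (A τ *ᵥ w))) :=
          Finset.sum_le_sum fun τ _ => mul_le_mul_of_nonneg_left
            ((hA τ).dotProduct_exp_mulVec_le (hU τ) hθ hθU w) (hp τ)
      _ = (∑ τ, p τ) * (w ⬝ᵥ w) + θ * ∑ τ, p τ * (w ⬝ᵥ A τ *ᵥ w)
            + θ ^ 2 * ∑ τ, p τ * ((A τ *ᵥ w) ⬝ᵥ (A τ *ᵥ w)) := by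
          rw [Finset.sum_mul, Finset.mul_sum, Finset.mul_sum, ← Finset.sum_add_distrib,
            ← Finset.sum_add_distrib]
          exact Finset.sum_congr rfl fun τ _ => by ring
      _ ≤ w ⬝ᵥ w + θ ^ 2 * (σ * (w ⬝ᵥ w)) := by
          rw [hp1, h1, one_mul, mul_zero, add_zero]
          gcongr
          exact hσ w
      _ = (θ ^ 2 * σ + 1) * (w ⬝ᵥ w) := by ring
      _ ≤ Real.exp (θ ^ 2 * σ) * (w ⬝ᵥ w) := by
          gcongr
          exact Real.add_one_le_exp _
  have hmain := sum_prod_mul_trace_exp_le p hp (fun τ => θ • A τ)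
    (fun τ => by rw [IsHermitian, conjTranspose_smul, hA τ]; simp) (Real.exp_nonneg _) hρ n 0
    (isHermitian_zero)
  simp only [zero_add, NormedSpace.exp_zero, trace_one, ← Finset.smul_sum] at hmain
  have htr : ∀ z : Fin n → T, (NormedSpace.exp (θ • ∑ j, A (z j))).trace
      = ∑ i, Real.exp (θ * (hherm z).eigenvalues i) := fun z => by
    rw [(hherm z).exp_smul_eq_funCalc, (hherm z).trace_funCalc]
  -- Markov's inequality in disguise: a quadratic form above x forces an eigenvalue above x, and the
  -- trace of the exponential dominates that single positive term.
  have hbad : ∀ z ∈ B, Real.exp (θ * x) ≤ (NormedSpace.exp (θ • ∑ j, A (z j))).trace := by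
    intro z hz
    obtain ⟨w, hw⟩ := hB z hz
    obtain ⟨i, hi⟩ : ∃ i, x < (hherm z).eigenvalues i := by
      by_contra! hcon
      refine absurd hw (not_lt.2 ?_)
      rw [(hherm z).dotProduct_mulVec_eq_sum, (hherm z).dotProduct_self_eq_sum, Finset.mul_sum]
      exact Finset.sum_le_sum fun i _ => mul_le_mul_of_nonneg_right (hcon i) (sq_nonneg _)
    rw [htr]
    refine le_trans (Real.exp_le_exp.2 (mul_le_mul_of_nonneg_left hi.le hθ)) ?_
    exact Finset.single_le_sum (f := fun i => Real.exp (θ * (hherm z).eigenvalues i))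
      (fun i _ => Real.exp_nonneg _) (Finset.mem_univ i)
  have hprod : ∀ z : Fin n → T, 0 ≤ ∏ j, p (z j) := fun z => Finset.prod_nonneg fun j _ => hp _
  have h5 : (∑ z ∈ B, ∏ j, p (z j)) * Real.exp (θ * x)
      ≤ Real.exp (θ ^ 2 * σ) ^ n * Fintype.card ι := by
    refine le_trans ?_ hmain
    rw [Finset.sum_mul]
    refine (Finset.sum_le_sum fun z hz => mul_le_mul_of_nonneg_left (hbad z hz) (hprod z)).trans ?_
    refine Finset.sum_le_sum_of_subset_of_nonneg (Finset.subset_univ B) fun z _ _ => ?_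
    refine mul_nonneg (hprod z) ?_
    rw [htr]
    exact Finset.sum_nonneg fun i _ => Real.exp_nonneg _
  rw [Real.exp_sub, Real.exp_nat_mul, ← mul_div_assoc, le_div_iff₀ (Real.exp_pos _),
    mul_comm (Fintype.card ι : ℝ)]
  exact h5

end MatrixBernstein

/-! ### From matrices to Euclidean norms by dilation. -/

section VectorBernstein

open Matrix

variable {κ T : Type*} [Fintype κ]

/-- The symmetric matrix with off-diagonal blocks `z` and `zᵀ`. -/
def vectorDilation (z : κ → ℝ) : Matrix (Unit ⊕ κ) (Unit ⊕ κ) ℝ :=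
  fromBlocks 0 (Matrix.of fun _ k => z k) (Matrix.of fun k _ => z k) 0

theorem vectorDilation_mulVec (z : κ → ℝ) (w : Unit ⊕ κ → ℝ) :
    vectorDilation z *ᵥ w
      = Sum.elim (fun _ => z ⬝ᵥ (w ∘ Sum.inr)) (w (Sum.inl ()) • z) := by
  rw [vectorDilation, fromBlocks_mulVec]
  congr 1
  · ext i
    simp [mulVec, dotProduct]
  · ext k
    simp [mulVec, dotProduct, mul_comm]

theorem dotProduct_sum_unit (w w' : Unit ⊕ κ → ℝ) :
    w ⬝ᵥ w' = w (Sum.inl ()) * w' (Sum.inl ()) + (w ∘ Sum.inr) ⬝ᵥ (w' ∘ Sum.inr) := by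
  simp [dotProduct, Fintype.sum_sum_type]

theorem sq_dotProduct_le (a b : κ → ℝ) : (a ⬝ᵥ b) ^ 2 ≤ (a ⬝ᵥ a) * (b ⬝ᵥ b) := by
  have h := Finset.sum_mul_sq_le_sq_mul_sq Finset.univ a b
  simpa only [dotProduct, sq] using h

theorem dotProduct_self_nonneg' (a : κ → ℝ) : 0 ≤ a ⬝ᵥ a :=
  Finset.sum_nonneg fun _ _ => mul_self_nonneg _

/-- A Bernstein inequality for the Euclidean norm of a sum of independent copies of a finitely
valued centered random vector. -/
theorem vector_bernstein [DecidableEq κ] [Fintype T] [DecidableEq T] (p : T → ℝ)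
    (hp : ∀ τ, 0 ≤ p τ) (hp1 : ∑ τ, p τ = 1) (z : T → κ → ℝ) (hmean : ∑ τ, p τ • z τ = 0)
    {U θ σ x : ℝ} (hU0 : 0 ≤ U) (hU : ∀ τ, z τ ⬝ᵥ z τ ≤ U ^ 2) (hθ : 0 ≤ θ)
    (hθU : θ * U ≤ 3 / 2) (hσ : ∑ τ, p τ * (z τ ⬝ᵥ z τ) ≤ σ) (hx : 0 ≤ x) (n : ℕ)
    (B : Finset (Fin n → T))
    (hB : ∀ y ∈ B, x ^ 2 < (∑ j, z (y j)) ⬝ᵥ (∑ j, z (y j))) :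
    ∑ y ∈ B, ∏ j, p (y j)
      ≤ (Fintype.card κ + 1) * Real.exp (n * (θ ^ 2 * σ) - θ * x) := by
  have hsum : ∀ (s : Finset (Fin n)) (y : Fin n → T),
      ∑ j ∈ s, vectorDilation (z (y j)) = vectorDilation (∑ j ∈ s, z (y j)) := by
    intro s y
    ext i j
    rcases i with i | i <;> rcases j with j | j <;>
      simp [vectorDilation, Matrix.sum_apply]
  have h := matrix_bernstein p hp hp1 (fun τ => vectorDilation (z τ)) ?_ ?_ (U := U) ?_ hθ hθU
    (σ := σ) ?_ n B (x := x) ?_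
  · rw [Fintype.card_sum, Fintype.card_unit] at h
    push_cast at h
    rwa [add_comm (1 : ℝ)] at h
  · intro τ
    ext i j
    rcases i with i | i <;> rcases j with j | j <;> simp [vectorDilation]
  · ext i j
    rcases i with i | i <;> rcases j with j | j
    · simp [vectorDilation, Matrix.sum_apply]
    · simpa [vectorDilation, Matrix.sum_apply, Finset.sum_apply] using congrFun hmean j
    · simpa [vectorDilation, Matrix.sum_apply, Finset.sum_apply] using congrFun hmean i
    · simp [vectorDilation, Matrix.sum_apply]
  · intro τ w
    rw [vectorDilation_mulVec, dotProduct_sum_unit, dotProduct_sum_unit w w]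
    simp only [Sum.elim_inl, Sum.elim_comp_inr, dotProduct_smul, smul_eq_mul]
    set a := w (Sum.inl ())
    set b := w ∘ Sum.inr
    have h1 := sq_dotProduct_le (z τ) b
    have hb := dotProduct_self_nonneg' b
    rw [dotProduct_comm b (z τ)]
    have h2 : (z τ ⬝ᵥ b) ^ 2 ≤ U ^ 2 * (b ⬝ᵥ b) :=
      h1.trans (mul_le_mul_of_nonneg_right (hU τ) hb)
    refine abs_le_of_sq_le_sq ?_ (by have := mul_self_nonneg a; positivity)
    nlinarith [mul_le_mul_of_nonneg_left h2 (sq_nonneg a),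
      mul_nonneg (sq_nonneg U) (sq_nonneg (a * a - b ⬝ᵥ b))]
  · intro w
    have hb := dotProduct_self_nonneg' (w ∘ Sum.inr)
    -- The square of the dilation is block diagonal with blocks |z|² and z zᵀ, both at most |z|², so
    -- the matrix variance is no larger than the scalar one.
    have h1 : ∀ τ, (vectorDilation (z τ) *ᵥ w) ⬝ᵥ (vectorDilation (z τ) *ᵥ w)
        ≤ (z τ ⬝ᵥ z τ) * (w ⬝ᵥ w) := by
      intro τ
      rw [vectorDilation_mulVec, dotProduct_sum_unit, dotProduct_sum_unit w w]
      simp only [Sum.elim_inl, Sum.elim_comp_inr, dotProduct_smul, smul_dotProduct, smul_eq_mul]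
      nlinarith [sq_dotProduct_le (z τ) (w ∘ Sum.inr)]
    calc ∑ τ, p τ * ((vectorDilation (z τ) *ᵥ w) ⬝ᵥ (vectorDilation (z τ) *ᵥ w))
        ≤ ∑ τ, p τ * ((z τ ⬝ᵥ z τ) * (w ⬝ᵥ w)) :=
          Finset.sum_le_sum fun τ _ => mul_le_mul_of_nonneg_left (h1 τ) (hp τ)
      _ = (∑ τ, p τ * (z τ ⬝ᵥ z τ)) * (w ⬝ᵥ w) := by
          rw [Finset.sum_mul]
          exact Finset.sum_congr rfl fun τ _ => by ring
      _ ≤ σ * (w ⬝ᵥ w) := mul_le_mul_of_nonneg_right hσ (dotProduct_self_nonneg' w)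
  · intro y hy
    have hy' := hB y hy
    rw [hsum]
    set S := ∑ j, z (y j)
    have hS := dotProduct_self_nonneg' S
    have hs := Real.sq_sqrt hS
    set s := √(S ⬝ᵥ S)
    have hs0 : 0 ≤ s := Real.sqrt_nonneg _
    -- The vector (|S|, S) is an eigenvector of the dilation with eigenvalue |S|.
    refine ⟨Sum.elim (fun _ => s) S, ?_⟩
    rw [vectorDilation_mulVec, dotProduct_sum_unit, dotProduct_sum_unit]
    simp only [Sum.elim_inl, Sum.elim_comp_inr, dotProduct_smul, smul_eq_mul]
    rw [← hs] at hy' ⊢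
    have hxs : x < s := lt_of_pow_lt_pow_left₀ 2 hs0 hy'
    have : 0 < s := hx.trans_lt hxs
    have : 0 < s ^ 2 := by positivity
    nlinarith

end VectorBernstein

/-! ### Duality, convexity and subgradients of the nuclear norm. -/

section NuclearNorm

open Matrix

variable {V : Type*} [Fintype V] [DecidableEq V]

theorem SymKernel.isHermitian {V : Type*} [Fintype V] (S : SymKernel V) :
    (S : Matrix V V ℝ).IsHermitian := S.2

theorem SymKernel.transpose_eq {V : Type*} [Fintype V] (S : SymKernel V) :
    (S : Matrix V V ℝ)ᵀ = S := by
  simpa [IsHermitian] using S.isHermitian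

/-- A real matrix that equals its transpose, as a symmetric kernel. -/
def SymKernel.ofTransposeEq {V : Type*} [Fintype V] (A : Matrix V V ℝ) (h : Aᵀ = A) :
    SymKernel V :=
  ⟨A, by rw [selfAdjoint.mem_iff, star_eq_conjTranspose, conjTranspose_eq_transpose_of_trivial, h]⟩

theorem nuclearNorm_eq_sum (S : SymKernel V) :
    nuclearNorm S = ∑ i, |S.isHermitian.eigenvalues i| := rfl

/-- Half of the trace duality, read off in an eigenbasis of `S`: only the diagonal of `M` in that
basis enters, so bounding the quadratic form is enough. -/
theorem trace_mul_le_nuclearNorm (S : SymKernel V) {M : Matrix V V ℝ} {K : ℝ}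
    (hM : ∀ w, |w ⬝ᵥ M *ᵥ w| ≤ K * (w ⬝ᵥ w)) :
    ((S : Matrix V V ℝ) * M).trace ≤ K * nuclearNorm S := by
  have h := S.isHermitian.trace_funCalc_mul (fun x => x) M
  rw [S.isHermitian.funCalc_id] at h
  rw [h, nuclearNorm_eq_sum, Finset.mul_sum]
  refine Finset.sum_le_sum fun i _ => ?_
  have h1 := hM (S.isHermitian.eigenMatrixᵀ i)
  rw [IsHermitian.eigenMatrix_dotProduct_self, mul_one] at h1
  refine (le_abs_self _).trans ?_
  rw [abs_mul, mul_comm]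
  gcongr

/-- The sign of a symmetric kernel. -/
noncomputable def signKernel (S : SymKernel V) : Matrix V V ℝ := S.isHermitian.funCalc Real.sign

/-- The matrix of the orthogonal projector onto the support of a symmetric kernel. -/
noncomputable def supportProj (S : SymKernel V) : Matrix V V ℝ :=
  S.isHermitian.funCalc (fun x => if x = 0 then 0 else 1)

theorem mul_sign_eq_abs (x : ℝ) : x * Real.sign x = |x| := by
  rcases lt_trichotomy x 0 with h | h | h
  · rw [Real.sign_of_neg h, abs_of_neg h]; ring
  · simp [h]
  · rw [Real.sign_of_pos h, abs_of_pos h]; ring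

theorem sign_mul_sign (x : ℝ) : Real.sign x * Real.sign x = if x = 0 then 0 else 1 := by
  rcases lt_trichotomy x 0 with h | h | h
  · simp [Real.sign_of_neg h, h.ne]
  · simp [h]
  · simp [Real.sign_of_pos h, h.ne']

theorem abs_sign (x : ℝ) : |Real.sign x| = if x = 0 then 0 else 1 := by
  rcases lt_trichotomy x 0 with h | h | h
  · simp [Real.sign_of_neg h, h.ne]
  · simp [h]
  · simp [Real.sign_of_pos h, h.ne']

theorem trace_mul_signKernel (S : SymKernel V) :
    ((S : Matrix V V ℝ) * signKernel S).trace = nuclearNorm S := by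
  have h := S.isHermitian.funCalc_mul (fun x => x) Real.sign
  rw [S.isHermitian.funCalc_id] at h
  rw [signKernel, h, IsHermitian.trace_funCalc, nuclearNorm_eq_sum]
  simp only [mul_sign_eq_abs]

theorem signKernel_transpose (S : SymKernel V) : (signKernel S)ᵀ = signKernel S :=
  S.isHermitian.funCalc_transpose _

theorem supportProj_transpose (S : SymKernel V) : (supportProj S)ᵀ = supportProj S :=
  S.isHermitian.funCalc_transpose _

theorem signKernel_mul_self (S : SymKernel V) : signKernel S * signKernel S = supportProj S := by
  rw [signKernel, IsHermitian.funCalc_mul, supportProj]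
  simp only [sign_mul_sign]

theorem supportProj_mul_self (S : SymKernel V) :
    supportProj S * supportProj S = supportProj S := by
  rw [supportProj, IsHermitian.funCalc_mul]
  congr 1
  ext x
  split_ifs <;> simp

theorem supportProj_mul (S : SymKernel V) : supportProj S * (S : Matrix V V ℝ) = S := by
  have h := S.isHermitian.funCalc_mul (fun x => if x = 0 then 0 else 1) (fun x => x)
  rw [S.isHermitian.funCalc_id] at h
  rw [supportProj, h]
  conv_rhs => rw [← S.isHermitian.funCalc_id]
  congr 1
  ext x
  split_ifs with hx <;> simp [hx]

theorem abs_dotProduct_signKernel_le (S : SymKernel V) (w : V → ℝ) :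
    |w ⬝ᵥ signKernel S *ᵥ w| ≤ w ⬝ᵥ supportProj S *ᵥ w := by
  rw [signKernel, supportProj, IsHermitian.dotProduct_funCalc_mulVec,
    IsHermitian.dotProduct_funCalc_mulVec]
  refine (Finset.abs_sum_le_sum_abs _ _).trans (Finset.sum_le_sum fun i _ => ?_)
  rw [abs_mul, abs_sign, abs_of_nonneg (sq_nonneg _)]

theorem mulVec_dotProduct_of_transpose_eq {V : Type*} [Fintype V] {A : Matrix V V ℝ} (hA : Aᵀ = A)
    (w z : V → ℝ) : (A *ᵥ w) ⬝ᵥ z = w ⬝ᵥ A *ᵥ z := by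
  rw [dotProduct_mulVec, ← mulVec_transpose, hA]

theorem supportProj_mulVec_dotProduct_self (S : SymKernel V) (w : V → ℝ) :
    (supportProj S *ᵥ w) ⬝ᵥ (supportProj S *ᵥ w) = w ⬝ᵥ supportProj S *ᵥ w := by
  rw [mulVec_dotProduct_of_transpose_eq (supportProj_transpose S), mulVec_mulVec,
    supportProj_mul_self]

theorem signKernel_mulVec_dotProduct_self (S : SymKernel V) (w : V → ℝ) :
    (signKernel S *ᵥ w) ⬝ᵥ (signKernel S *ᵥ w) = w ⬝ᵥ supportProj S *ᵥ w := by
  rw [mulVec_dotProduct_of_transpose_eq (signKernel_transpose S), mulVec_mulVec,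
    signKernel_mul_self]

theorem compl_supportProj_mulVec_dotProduct_self (S : SymKernel V) (w : V → ℝ) :
    ((1 - supportProj S) *ᵥ w) ⬝ᵥ ((1 - supportProj S) *ᵥ w)
      = w ⬝ᵥ w - w ⬝ᵥ supportProj S *ᵥ w := by
  have h := supportProj_mulVec_dotProduct_self S w
  rw [sub_mulVec, one_mulVec, sub_dotProduct, dotProduct_sub, dotProduct_sub, h,
    dotProduct_comm (supportProj S *ᵥ w) w]
  ring

theorem compl_supportProj_transpose (S : SymKernel V) :
    (1 - supportProj S)ᵀ = 1 - supportProj S := by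
  rw [transpose_sub, transpose_one, supportProj_transpose]

theorem dotProduct_supportProj_le (S : SymKernel V) (w : V → ℝ) :
    w ⬝ᵥ supportProj S *ᵥ w ≤ w ⬝ᵥ w := by
  have h := dotProduct_self_nonneg' ((1 - supportProj S) *ᵥ w)
  rw [compl_supportProj_mulVec_dotProduct_self] at h
  linarith

theorem compl_supportProj_mulVec_le (S : SymKernel V) (w : V → ℝ) :
    ((1 - supportProj S) *ᵥ w) ⬝ᵥ ((1 - supportProj S) *ᵥ w) ≤ w ⬝ᵥ w := by
  have h := dotProduct_self_nonneg' (supportProj S *ᵥ w)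
  rw [supportProj_mulVec_dotProduct_self] at h
  rw [compl_supportProj_mulVec_dotProduct_self]
  linarith

theorem abs_dotProduct_signKernel_le_self (S : SymKernel V) (w : V → ℝ) :
    |w ⬝ᵥ signKernel S *ᵥ w| ≤ 1 * (w ⬝ᵥ w) := by
  rw [one_mul]
  exact (abs_dotProduct_signKernel_le S w).trans (dotProduct_supportProj_le S w)

/-- The nuclear norm is convex along segments. -/
theorem nuclearNorm_combo_le (S₀ S₁ : SymKernel V) {a b : ℝ} (ha : 0 ≤ a) (hb : 0 ≤ b) :
    nuclearNorm (a • S₁ + b • S₀) ≤ a * nuclearNorm S₁ + b * nuclearNorm S₀ := by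
  rw [← trace_mul_signKernel (a • S₁ + b • S₀)]
  have hM := abs_dotProduct_signKernel_le_self (a • S₁ + b • S₀)
  -- The sign of the combination is a dual witness: its trace pairing is linear, equals the nuclear
  -- norm at the combination, and is at most the nuclear norm at each summand.
  set M := signKernel (a • S₁ + b • S₀)
  have h1 := mul_le_mul_of_nonneg_left (trace_mul_le_nuclearNorm S₁ hM) ha
  have h0 := mul_le_mul_of_nonneg_left (trace_mul_le_nuclearNorm S₀ hM) hb
  rw [one_mul] at h0 h1
  have h : ((a • S₁ + b • S₀ : SymKernel V) : Matrix V V ℝ)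
      = a • (S₁ : Matrix V V ℝ) + b • (S₀ : Matrix V V ℝ) := rfl
  rw [h, add_mul, smul_mul_assoc, smul_mul_assoc, trace_add, trace_smul, trace_smul, smul_eq_mul,
    smul_eq_mul]
  exact add_le_add h1 h0

/-- The part of a symmetric matrix that acts in the orthogonal complement of the support. -/
noncomputable def complPart (S₀ : SymKernel V) (Δ : Matrix V V ℝ) (hΔ : Δᵀ = Δ) : SymKernel V :=
  SymKernel.ofTransposeEq ((1 - supportProj S₀) * Δ * (1 - supportProj S₀)) (by
    rw [transpose_mul, transpose_mul, hΔ, compl_supportProj_transpose, mul_assoc])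

/-- With Q = 1 - P, test `S₁` against sign(S₀) + Q sign(N) Q. This witness has norm at most one
because its two pieces are bounded by w·Pw and |Qw|², which add up to |w|². As Q S₀ = 0, the second
piece pairs with `S₁` to give the full nuclear norm of the off-support part N of the difference. -/
theorem nuclearNorm_sub_ge (S₀ S₁ : SymKernel V)
    (hΔ : ((S₁ : Matrix V V ℝ) - (S₀ : Matrix V V ℝ))ᵀ
      = (S₁ : Matrix V V ℝ) - (S₀ : Matrix V V ℝ)) :
    (((S₁ : Matrix V V ℝ) - S₀) * signKernel S₀).trace
      + nuclearNorm (complPart S₀ ((S₁ : Matrix V V ℝ) - S₀) hΔ)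
      ≤ nuclearNorm S₁ - nuclearNorm S₀ := by
  set N := complPart S₀ ((S₁ : Matrix V V ℝ) - S₀) hΔ with hN
  set Q := 1 - supportProj S₀ with hQ
  have hQS : Q * (S₀ : Matrix V V ℝ) = 0 := by
    rw [hQ, sub_mul, one_mul, supportProj_mul, sub_self]
  have hNQ : (N : Matrix V V ℝ) = Q * (S₁ : Matrix V V ℝ) * Q := by
    have : (N : Matrix V V ℝ) = Q * ((S₁ : Matrix V V ℝ) - S₀) * Q := rfl
    rw [this, mul_sub Q, hQS, sub_zero]
  have hV : ∀ w, |w ⬝ᵥ (signKernel S₀ + Q * signKernel N * Q) *ᵥ w| ≤ 1 * (w ⬝ᵥ w) := by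
    intro w
    have h1 := abs_dotProduct_signKernel_le S₀ w
    have h2 := abs_dotProduct_signKernel_le_self N (Q *ᵥ w)
    rw [one_mul, hQ, compl_supportProj_mulVec_dotProduct_self, ← hQ,
      mulVec_dotProduct_of_transpose_eq (compl_supportProj_transpose S₀), mulVec_mulVec,
      mulVec_mulVec, ← hQ] at h2
    rw [add_mulVec, dotProduct_add, one_mul]
    refine (abs_add_le _ _).trans ?_
    linarith
  have h := trace_mul_le_nuclearNorm S₁ hV
  have h1 : ((S₁ : Matrix V V ℝ) * (Q * signKernel N * Q)).trace = nuclearNorm N := by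
    rw [← trace_mul_signKernel N, hNQ, ← mul_assoc, trace_mul_comm]
    simp only [mul_assoc]
  rw [one_mul, mul_add, trace_add, h1] at h
  rw [sub_mul, trace_sub, trace_mul_signKernel S₀]
  linarith

end NuclearNorm

/-! ### The projector onto the support as a spectral function. -/

section SupportProjection

open Matrix

variable {V : Type*} [Fintype V] [DecidableEq V]

/-- The image lies in the span of eigenvectors with nonzero eigenvalue, and the residual is
orthogonal to it: if Sψ = σψ with σ ≠ 0, then ψ is in the range of S and is fixed by the spectral
projector. -/
theorem kernelSupport_starProjection (S : SymKernel V) (x : EuclideanSpace ℝ V) :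
    (kernelSupport S).starProjection x = WithLp.toLp 2 (supportProj S *ᵥ x.ofLp) := by
  refine Submodule.eq_starProjection_of_mem_of_inner_eq_zero (K := kernelSupport S) ?_ ?_
  · have h1 : WithLp.toLp 2 (supportProj S *ᵥ x.ofLp)
        = ∑ i, ((if S.isHermitian.eigenvalues i = 0 then 0 else 1)
          * (S.isHermitian.eigenMatrixᵀ *ᵥ x.ofLp) i) • S.isHermitian.eigenvectorBasis i := by
      ext v
      rw [supportProj, IsHermitian.funCalc, mul_assoc, ← mulVec_mulVec, ← mulVec_mulVec]
      simp only [WithLp.ofLp_sum, WithLp.ofLp_smul, Finset.sum_apply, Pi.smul_apply,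
        smul_eq_mul]
      rw [mulVec, dotProduct]
      refine Finset.sum_congr rfl fun i _ => ?_
      rw [mulVec_diagonal, mul_comm]
      congr 1
    rw [h1]
    refine Submodule.sum_mem _ fun i _ => ?_
    by_cases hi : S.isHermitian.eigenvalues i = 0
    · simp [hi]
    · refine Submodule.smul_mem _ _ (Submodule.subset_span ⟨_, hi, ?_⟩)
      ext v
      have h2 := congrFun (S.isHermitian.mulVec_eigenvectorBasis i) v
      simpa [toEuclideanLin] using h2
  · intro w hw
    refine Submodule.span_induction (p := fun w _ =>
      inner ℝ (x - WithLp.toLp 2 (supportProj S *ᵥ x.ofLp)) w = 0) ?_ ?_ ?_ ?_ hw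
    · rintro ψ ⟨σ, hσ, hψ⟩
      have h3 : (S : Matrix V V ℝ) *ᵥ ψ.ofLp = σ • ψ.ofLp := by
        have := congrArg WithLp.ofLp hψ
        simpa [toEuclideanLin] using this
      have h4 : supportProj S *ᵥ ψ.ofLp = ψ.ofLp := by
        have h5 : supportProj S *ᵥ ((S : Matrix V V ℝ) *ᵥ ψ.ofLp)
            = (S : Matrix V V ℝ) *ᵥ ψ.ofLp := by
          rw [mulVec_mulVec, supportProj_mul]
        rw [h3, mulVec_smul] at h5
        exact smul_right_injective _ hσ h5
      rw [EuclideanSpace.inner_eq_star_dotProduct]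
      simp only [star_trivial, WithLp.ofLp_sub, dotProduct_sub]
      rw [← mulVec_dotProduct_of_transpose_eq (supportProj_transpose S), h4, sub_self]
    · simp
    · intro a b _ _ ha hb
      rw [inner_add_right, ha, hb, add_zero]
    · intro a b _ hb
      rw [inner_smul_right, hb, mul_zero]

theorem norm_sq_toLp {V : Type*} [Fintype V] (y : V → ℝ) :
    ‖(WithLp.toLp 2 y : EuclideanSpace ℝ V)‖ ^ 2 = y ⬝ᵥ y := by
  rw [EuclideanSpace.norm_sq_eq]
  simp [dotProduct, sq]

theorem norm_sq_kernelSupport_starProjection (S : SymKernel V) (x : EuclideanSpace ℝ V) :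
    ‖(kernelSupport S).starProjection x‖ ^ 2 = x.ofLp ⬝ᵥ supportProj S *ᵥ x.ofLp := by
  rw [kernelSupport_starProjection, norm_sq_toLp, supportProj_mulVec_dotProduct_self]

end SupportProjection

/-! ### Optimality conditions and the deterministic error bound. -/

section OracleInequality

open Matrix

variable {V : Type*} [Fintype V] [DecidableEq V]

theorem l2NormSq_eq_trace {V : Type*} [Fintype V] (A : Matrix V V ℝ) :
    l2NormSq A = (Aᵀ * A).trace / (Fintype.card V : ℝ) ^ 2 := by
  rw [l2NormSq]
  congr 1
  rw [Finset.sum_comm]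
  simp only [trace, diag_apply, mul_apply, transpose_apply, sq_abs]
  simp only [sq]

open scoped MatrixOrder in
theorem l2NormSq_sqrtMatrix_mul {W : Matrix V V ℝ} (hW : W.PosSemidef) (S : SymKernel V) :
    l2NormSq (sqrtMatrix W * (S : Matrix V V ℝ))
      = ((S : Matrix V V ℝ) * W * S).trace / (Fintype.card V : ℝ) ^ 2 := by
  have h1 : (sqrtMatrix W)ᵀ = sqrtMatrix W := by
    have h := (CFC.sqrt_nonneg W).posSemidef.isHermitian
    simpa [IsHermitian, sqrtMatrix] using h
  have h2 : sqrtMatrix W * sqrtMatrix W = W := CFC.sqrt_mul_sqrt_self W hW.nonneg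
  rw [l2NormSq_eq_trace, transpose_mul, S.transpose_eq, h1, ← mul_assoc,
    mul_assoc (S : Matrix V V ℝ), h2]

/-- The symmetrized matrix unit `(e_u ⊗ e_v + e_v ⊗ e_u) / 2`. -/
noncomputable def symUnit {V : Type*} [DecidableEq V] (u v : V) : Matrix V V ℝ :=
  (1 / 2 : ℝ) • (single u v 1 + single v u 1)

theorem symUnit_transpose {V : Type*} [DecidableEq V] (u v : V) : (symUnit u v)ᵀ = symUnit u v := by
  rw [symUnit, transpose_smul, transpose_add, transpose_single, transpose_single, add_comm]

/-- Symmetrizing the matrix unit loses nothing against symmetric kernels, and it makes the summands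
eligible for a symmetric matrix Bernstein bound. -/
theorem trace_mul_symUnit (S : SymKernel V) (u v : V) :
    ((S : Matrix V V ℝ) * symUnit u v).trace = (S : Matrix V V ℝ) u v := by
  have hs : (S : Matrix V V ℝ) v u = (S : Matrix V V ℝ) u v :=
    congrFun (congrFun S.transpose_eq u) v
  rw [symUnit, mul_smul_comm, trace_smul, mul_add, trace_add, trace_mul_single, trace_mul_single]
  simp only [hs, smul_eq_mul]
  simp
  ring

/-- The symmetrized empirical matrix `n⁻¹ ∑ⱼ yⱼ (e_{xⱼ} ⊗ e_{xⱼ'})`. -/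
noncomputable def empiricalKernel {V : Type*} [DecidableEq V] {n : ℕ} (x x' : Fin n → V)
    (y : Fin n → ℝ) : Matrix V V ℝ :=
  (1 / n : ℝ) • ∑ j, y j • symUnit (x j) (x' j)

theorem trace_mul_empiricalKernel {n : ℕ} (x x' : Fin n → V) (y : Fin n → ℝ) (S : SymKernel V) :
    ((S : Matrix V V ℝ) * empiricalKernel x x' y).trace
      = (1 / n : ℝ) * ∑ j, y j * (S : Matrix V V ℝ) (x j) (x' j) := by
  rw [empiricalKernel, mul_smul_comm, trace_smul, smul_eq_mul, Finset.mul_sum, trace_sum]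
  congr 1
  exact Finset.sum_congr rfl fun j _ => by
    rw [mul_smul_comm, trace_smul, smul_eq_mul, trace_mul_symUnit]

theorem empiricalKernel_transpose {V : Type*} [DecidableEq V] {n : ℕ} (x x' : Fin n → V) (y : Fin n → ℝ) :
    (empiricalKernel x x' y)ᵀ = empiricalKernel x x' y := by
  simp only [empiricalKernel, transpose_smul, transpose_sum, symUnit_transpose]

theorem penalizedRisk_eq {W : Matrix V V ℝ} (hW : W.PosSemidef) (ε ε' : ℝ) {n : ℕ}
    (x x' : Fin n → V) (y : Fin n → ℝ) (S : SymKernel V) :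
    penalizedRisk W ε ε' x x' y S
      = (((S : Matrix V V ℝ) * S).trace + ε' * ((S : Matrix V V ℝ) * W * S).trace)
          / (Fintype.card V : ℝ) ^ 2
        - 2 * ((S : Matrix V V ℝ) * empiricalKernel x x' y).trace + ε * nuclearNorm S := by
  rw [penalizedRisk, l2NormSq_sqrtMatrix_mul hW, l2NormSq_eq_trace, S.transpose_eq,
    trace_mul_empiricalKernel]
  ring

theorem trace_mul_mul_comm_of_transpose_eq {V : Type*} [Fintype V] {A B C : Matrix V V ℝ} (hA : Aᵀ = A)
    (hB : Bᵀ = B) (hC : Cᵀ = C) : (A * B * C).trace = (C * B * A).trace := by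
  rw [← trace_transpose, transpose_mul, transpose_mul, hA, hB, hC, mul_assoc]

/-- The first order optimality condition for a minimizer of the penalized empirical risk. -/
theorem minimizer_variational_inequality {W : Matrix V V ℝ} (hW : W.PosSemidef) {ε ε' : ℝ}
    (hε : 0 ≤ ε) {n : ℕ} {x x' : Fin n → V} {y : Fin n → ℝ} {D : Set (SymKernel V)}
    (hD : Convex ℝ D) {S₀ S₁ : SymKernel V} (h₀ : S₀ ∈ D) (h₁ : S₁ ∈ D)
    (hmin : IsMinOn (penalizedRisk W ε ε' x x' y) D S₁) :
    2 * ((((S₁ : Matrix V V ℝ) - S₀) * S₁).trace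
        + ε' * (((S₁ : Matrix V V ℝ) - S₀) * W * S₁).trace) / (Fintype.card V : ℝ) ^ 2
      - 2 * (((S₁ : Matrix V V ℝ) - S₀) * empiricalKernel x x' y).trace
      + ε * (nuclearNorm S₁ - nuclearNorm S₀) ≤ 0 := by
  have hWT : Wᵀ = W := by simpa [IsHermitian] using hW.isHermitian
  have hS₁ := S₁.transpose_eq
  have hS₀ := S₀.transpose_eq
  set R := empiricalKernel x x' y
  set Δ := (S₁ : Matrix V V ℝ) - S₀ with hΔ
  have hΔT : Δᵀ = Δ := by rw [hΔ, transpose_sub, hS₁, hS₀]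
  set q := ((Δ * Δ).trace + ε' * (Δ * W * Δ).trace) / (Fintype.card V : ℝ) ^ 2 with hq
  set a := 2 * ((Δ * S₁).trace + ε' * (Δ * W * S₁).trace) / (Fintype.card V : ℝ) ^ 2
      - 2 * (Δ * R).trace + ε * (nuclearNorm S₁ - nuclearNorm S₀) with ha
  -- Move from `S₁` a fraction τ of the way to `S₀`: minimality bounds the first-order term by τ
  -- times the quadratic one, with the nuclear norm entering through convexity only.
  have key : ∀ τ : ℝ, 0 < τ → τ ≤ 1 → a ≤ τ * q := by
    intro τ hτ hτ1
    have hmem : (1 - τ) • S₁ + τ • S₀ ∈ D := hD h₁ h₀ (by linarith) hτ.le (by ring)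
    have h1 := isMinOn_iff.1 hmin _ hmem
    have hco : (((1 - τ) • S₁ + τ • S₀ : SymKernel V) : Matrix V V ℝ)
        = (S₁ : Matrix V V ℝ) - τ • Δ := by
      have : (((1 - τ) • S₁ + τ • S₀ : SymKernel V) : Matrix V V ℝ)
        = (1 - τ) • (S₁ : Matrix V V ℝ) + τ • (S₀ : Matrix V V ℝ) := rfl
      rw [this, hΔ]
      module
    rw [penalizedRisk_eq hW, penalizedRisk_eq hW, hco] at h1
    have hnuc := mul_le_mul_of_nonneg_left
      (nuclearNorm_combo_le S₀ S₁ (by linarith : 0 ≤ 1 - τ) hτ.le) hε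
    have e1 : (((S₁ : Matrix V V ℝ) - τ • Δ) * ((S₁ : Matrix V V ℝ) - τ • Δ)).trace
        = ((S₁ : Matrix V V ℝ) * S₁).trace - 2 * τ * (Δ * S₁).trace
          + τ ^ 2 * (Δ * Δ).trace := by
      simp only [sub_mul, mul_sub, smul_mul_assoc, mul_smul_comm, trace_sub, trace_smul,
        smul_eq_mul]
      rw [trace_mul_comm (S₁ : Matrix V V ℝ) Δ]
      ring
    have e2 : (((S₁ : Matrix V V ℝ) - τ • Δ) * W * ((S₁ : Matrix V V ℝ) - τ • Δ)).trace
        = ((S₁ : Matrix V V ℝ) * W * S₁).trace - 2 * τ * (Δ * W * S₁).trace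
          + τ ^ 2 * (Δ * W * Δ).trace := by
      simp only [sub_mul, mul_sub, smul_mul_assoc, mul_smul_comm, trace_sub, trace_smul,
        smul_eq_mul]
      rw [trace_mul_mul_comm_of_transpose_eq hS₁ hWT hΔT]
      ring
    have e3 : (((S₁ : Matrix V V ℝ) - τ • Δ) * R).trace
        = ((S₁ : Matrix V V ℝ) * R).trace - τ * (Δ * R).trace := by
      simp only [sub_mul, smul_mul_assoc, trace_sub, trace_smul, smul_eq_mul]
    rw [e1, e2, e3] at h1
    have h2 : τ * a ≤ τ * (τ * q) := by
      rw [ha, hq]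
      set c := (Fintype.card V : ℝ) ^ 2
      have e4 : (((S₁ : Matrix V V ℝ) * S₁).trace - 2 * τ * (Δ * S₁).trace + τ ^ 2 * (Δ * Δ).trace
          + ε' * (((S₁ : Matrix V V ℝ) * W * S₁).trace - 2 * τ * (Δ * W * S₁).trace
            + τ ^ 2 * (Δ * W * Δ).trace)) / c
          = (((S₁ : Matrix V V ℝ) * S₁).trace + ε' * ((S₁ : Matrix V V ℝ) * W * S₁).trace) / c
            - τ * (2 * ((Δ * S₁).trace + ε' * (Δ * W * S₁).trace) / c)
            + τ * (τ * (((Δ * Δ).trace + ε' * (Δ * W * Δ).trace) / c)) := by ring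
      rw [e4] at h1
      linarith
    exact le_of_mul_le_mul_left h2 hτ
  by_contra! hpos
  rcases le_or_gt q 0 with h | h
  · have := key 1 one_pos le_rfl
    linarith
  · have h1 := key (min 1 (a / (2 * q))) (lt_min one_pos (by positivity)) (min_le_left _ _)
    have h2 : min 1 (a / (2 * q)) * q ≤ a / (2 * q) * q :=
      mul_le_mul_of_nonneg_right (min_le_right _ _) h.le
    have h3 : a / (2 * q) * q = a / 2 := by field_simp
    linarith

/-- By symmetry of `Δ`, the trace is a sum of inner products of Δφ_k and Bφ_k; Cauchy–Schwarz can
put the weights on one side and their inverses on the other. -/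
theorem abs_trace_mul_le_weighted {V K : Type*} [Fintype V] [Fintype K] {φ : K → V → ℝ}
    (hφ : ∀ M : Matrix V V ℝ, M.trace = ∑ k, φ k ⬝ᵥ M *ᵥ φ k) {a : K → ℝ} (ha : ∀ k, 0 < a k)
    {Δ : Matrix V V ℝ} (hΔ : Δᵀ = Δ) (B : Matrix V V ℝ) :
    |(Δ * B).trace| ≤ √(∑ k, a k * ((Δ *ᵥ φ k) ⬝ᵥ (Δ *ᵥ φ k)))
      * √(∑ k, (B *ᵥ φ k) ⬝ᵥ (B *ᵥ φ k) / a k) := by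
  have h1 : ∀ k, |φ k ⬝ᵥ (Δ * B) *ᵥ φ k| ≤ √(a k * ((Δ *ᵥ φ k) ⬝ᵥ (Δ *ᵥ φ k)))
      * √((B *ᵥ φ k) ⬝ᵥ (B *ᵥ φ k) / a k) := by
    intro k
    have hnn := dotProduct_self_nonneg' (Δ *ᵥ φ k)
    rw [← mulVec_mulVec, ← mulVec_dotProduct_of_transpose_eq hΔ,
      ← Real.sqrt_mul (mul_nonneg (ha k).le hnn)]
    refine Real.abs_le_sqrt ((sq_dotProduct_le _ _).trans (le_of_eq ?_))
    have := (ha k).ne'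
    field_simp
  rw [hφ]
  refine (Finset.abs_sum_le_sum_abs _ _).trans ((Finset.sum_le_sum fun k _ => h1 k).trans ?_)
  refine (Real.sum_mul_le_sqrt_mul_sqrt _ _ _).trans (le_of_eq ?_)
  congr 2
  · exact Finset.sum_congr rfl fun k _ =>
      Real.sq_sqrt (mul_nonneg (ha k).le (dotProduct_self_nonneg' _))
  · exact Finset.sum_congr rfl fun k _ =>
      Real.sq_sqrt (div_nonneg (dotProduct_self_nonneg' _) (ha k).le)

set_option maxHeartbeats 1000000 in
/-- A deterministic oracle inequality: the error is controlled by the noise matrix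
`Ξ = R - S₀ / m²`, provided that `Ξ` is dominated by the nuclear penalty off the support. -/
theorem oracle_inequality {W : Matrix V V ℝ} (hW : W.PosSemidef) {ε ε' : ℝ} (hε : 0 ≤ ε)
    (hε' : 0 ≤ ε') {n : ℕ} {x x' : Fin n → V} {y : Fin n → ℝ} {D : Set (SymKernel V)}
    (hD : Convex ℝ D) {S₀ S₁ : SymKernel V} (h₀ : S₀ ∈ D) (h₁ : S₁ ∈ D)
    (hmin : IsMinOn (penalizedRisk W ε ε' x x' y) D S₁)
    {K : Type*} [Fintype K] {φ : K → V → ℝ} {lam : K → ℝ} (hlam : ∀ k, 0 ≤ lam k)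
    (hφ : ∀ M : Matrix V V ℝ, M.trace = ∑ k, φ k ⬝ᵥ M *ᵥ φ k)
    (hWφ : ∀ k, W *ᵥ φ k = lam k • φ k) (hcard : 0 < Fintype.card V)
    {Ξ : Matrix V V ℝ}
    (hΞ : Ξ = empiricalKernel x x' y - ((Fintype.card V : ℝ) ^ 2)⁻¹ • (S₀ : Matrix V V ℝ))
    (hnoise : ∀ w, |((1 - supportProj S₀) *ᵥ w) ⬝ᵥ Ξ *ᵥ ((1 - supportProj S₀) *ᵥ w)|
      ≤ ε / 2 * (w ⬝ᵥ w)) :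
    l2NormSq ((S₁ : Matrix V V ℝ) - (S₀ : Matrix V V ℝ))
      ≤ ε' * l2NormSq (sqrtMatrix W * (S₀ : Matrix V V ℝ))
        + (Fintype.card V : ℝ) ^ 2 *
          (8 * ∑ k, (Ξ *ᵥ supportProj S₀ *ᵥ φ k) ⬝ᵥ (Ξ *ᵥ supportProj S₀ *ᵥ φ k)
              / (1 + ε' * lam k)
            + ε ^ 2 / 2 * ∑ k, φ k ⬝ᵥ supportProj S₀ *ᵥ φ k / (1 + ε' * lam k)) := by
  have hWT : Wᵀ = W := by simpa [IsHermitian] using hW.isHermitian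
  have hS₁ := S₁.transpose_eq
  have hS₀ := S₀.transpose_eq
  have hΔT : ((S₁ : Matrix V V ℝ) - (S₀ : Matrix V V ℝ))ᵀ
      = (S₁ : Matrix V V ℝ) - (S₀ : Matrix V V ℝ) := by rw [transpose_sub, hS₁, hS₀]
  have hvar := minimizer_variational_inequality hW hε hD h₀ h₁ hmin
  have hΞT : Ξᵀ = Ξ := by
    rw [hΞ, transpose_sub, transpose_smul, hS₀, empiricalKernel_transpose]
  rw [l2NormSq_sqrtMatrix_mul hW, l2NormSq_eq_trace, hΔT]
  set R := empiricalKernel x x' y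
  set P := supportProj S₀ with hP
  have hPT : Pᵀ = P := supportProj_transpose S₀
  have hQT : (1 - P)ᵀ = 1 - P := compl_supportProj_transpose S₀
  set Δ := (S₁ : Matrix V V ℝ) - S₀ with hΔ
  set N := complPart S₀ Δ hΔT
  have hN : (N : Matrix V V ℝ) = (1 - P) * Δ * (1 - P) := rfl
  have hnuc : ε * ((Δ * signKernel S₀).trace + nuclearNorm N)
      ≤ ε * (nuclearNorm S₁ - nuclearNorm S₀) :=
    mul_le_mul_of_nonneg_left (nuclearNorm_sub_ge S₀ S₁ hΔT) hε
  set m2 := (Fintype.card V : ℝ) ^ 2 with hm2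
  have hm2pos : 0 < m2 := by positivity
  have ha : ∀ k, 0 < 1 + ε' * lam k := fun k => by
    have := mul_nonneg hε' (hlam k); linarith
  -- the quadratic part
  have hS1 : (S₁ : Matrix V V ℝ) = Δ + S₀ := by rw [hΔ, sub_add_cancel]
  have hpos : 0 ≤ ((Δ + (S₀ : Matrix V V ℝ)) * W * (Δ + S₀)).trace := by
    have h := (hW.conjTranspose_mul_mul_same (Δ + (S₀ : Matrix V V ℝ))).trace_nonneg
    rwa [conjTranspose_eq_transpose_of_trivial, transpose_add, hΔT, hS₀] at h
  have hexp : ((Δ + (S₀ : Matrix V V ℝ)) * W * (Δ + S₀)).trace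
      = (Δ * W * Δ).trace + 2 * (Δ * W * S₀).trace + ((S₀ : Matrix V V ℝ) * W * S₀).trace := by
    simp only [add_mul, mul_add, trace_add]
    rw [trace_mul_mul_comm_of_transpose_eq hS₀ hWT hΔT]
    ring
  have hR : (Δ * R).trace = (Δ * Ξ).trace + (Δ * S₀).trace / m2 := by
    rw [hΞ, mul_sub, mul_smul_comm, trace_sub, trace_smul, smul_eq_mul]
    ring
  have hsplit1 : (Δ * (S₁ : Matrix V V ℝ)).trace = (Δ * Δ).trace + (Δ * S₀).trace := by
    rw [hS1, mul_add, trace_add]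
  have hsplit2 : (Δ * W * (S₁ : Matrix V V ℝ)).trace
      = (Δ * W * Δ).trace + (Δ * W * S₀).trace := by
    rw [hS1, mul_add, trace_add]
  -- the noise off the support
  have hoff : ((N : Matrix V V ℝ) * Ξ).trace ≤ ε / 2 * nuclearNorm N := by
    have hM : ∀ w, |w ⬝ᵥ ((1 - P) * Ξ * (1 - P)) *ᵥ w| ≤ ε / 2 * (w ⬝ᵥ w) := by
      intro w
      rw [mul_assoc, ← mulVec_mulVec, ← mulVec_mulVec, ← mulVec_dotProduct_of_transpose_eq hQT]
      exact hnoise w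
    have h := trace_mul_le_nuclearNorm N hM
    have hidem : (1 - P) * (1 - P) = 1 - P := by
      rw [sub_mul, one_mul, mul_sub, mul_one, hP, supportProj_mul_self, sub_self, sub_zero]
    have e : ((N : Matrix V V ℝ) * ((1 - P) * Ξ * (1 - P))).trace
        = ((N : Matrix V V ℝ) * Ξ).trace := by
      rw [← mul_assoc, ← mul_assoc, trace_mul_comm, hN]
      have e1 : (1 - P) * ((1 - P) * Δ * (1 - P) * (1 - P) * Ξ)
          = ((1 - P) * (1 - P)) * Δ * ((1 - P) * (1 - P)) * Ξ := by simp only [mul_assoc]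
      rw [e1, hidem]
    rw [e] at h
    exact h
  -- the noise on the support
  set A2 := ∑ k, (1 + ε' * lam k) * ((Δ *ᵥ φ k) ⬝ᵥ (Δ *ᵥ φ k)) with hA2
  set N2 := ∑ k, (Ξ *ᵥ P *ᵥ φ k) ⬝ᵥ (Ξ *ᵥ P *ᵥ φ k) / (1 + ε' * lam k) with hN2
  set Q := ∑ k, φ k ⬝ᵥ P *ᵥ φ k / (1 + ε' * lam k) with hQ
  have hN2nn : 0 ≤ N2 := Finset.sum_nonneg fun k _ =>
    div_nonneg (dotProduct_self_nonneg' _) (ha k).le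
  have hQnn : 0 ≤ Q := Finset.sum_nonneg fun k _ => by
    refine div_nonneg ?_ (ha k).le
    rw [hP, ← supportProj_mulVec_dotProduct_self]
    exact dotProduct_self_nonneg' _
  have hA2nn : 0 ≤ A2 := Finset.sum_nonneg fun k _ =>
    mul_nonneg (ha k).le (dotProduct_self_nonneg' _)
  -- The weights 1 + ε'λ_k make the Δ-side of Cauchy–Schwarz equal to the quadratic form of the
  -- penalized risk, so it can later be absorbed.
  have hA2eq : A2 = (Δ * Δ).trace + ε' * (Δ * W * Δ).trace := by
    have h1 : (Δ * W * Δ).trace = (Δ * Δ * W).trace := by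
      rw [trace_mul_comm, ← mul_assoc]
    rw [h1, hφ (Δ * Δ), hφ (Δ * Δ * W), Finset.mul_sum, ← Finset.sum_add_distrib]
    refine Finset.sum_congr rfl fun k _ => ?_
    rw [← mulVec_mulVec (φ k) (Δ * Δ) W, hWφ, mulVec_smul, dotProduct_smul, ← mulVec_mulVec,
      mulVec_dotProduct_of_transpose_eq hΔT, smul_eq_mul]
    ring
  have hcs1 := abs_trace_mul_le_weighted hφ ha hΔT (Ξ * P)
  have hcs2 := abs_trace_mul_le_weighted hφ ha hΔT ((1 - P) * Ξ * P)
  have hcs3 := abs_trace_mul_le_weighted hφ ha hΔT (signKernel S₀)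
  simp only [← mulVec_mulVec] at hcs1 hcs2
  simp only [signKernel_mulVec_dotProduct_self] at hcs3
  have hcs2' : ∑ k, ((1 - P) *ᵥ Ξ *ᵥ P *ᵥ φ k) ⬝ᵥ ((1 - P) *ᵥ Ξ *ᵥ P *ᵥ φ k) / (1 + ε' * lam k)
      ≤ N2 := by
    refine Finset.sum_le_sum fun k _ => ?_
    have := (ha k).le
    gcongr
    exact compl_supportProj_mulVec_le S₀ _
  have hcs2'' := hcs2.trans (mul_le_mul_of_nonneg_left (Real.sqrt_le_sqrt hcs2')
    (Real.sqrt_nonneg _))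
  -- Ξ = (1-P)Ξ(1-P) + (1-P)ΞP + PΞ, and symmetry replaces PΞ by ΞP under the trace; thus both
  -- remaining pieces act on the vectors Pφ_k.
  have hdecomp : (Δ * Ξ).trace = ((N : Matrix V V ℝ) * Ξ).trace + (Δ * (Ξ * P)).trace
      + (Δ * ((1 - P) * Ξ * P)).trace := by
    have e1 : ((N : Matrix V V ℝ) * Ξ).trace = (Δ * ((1 - P) * Ξ * (1 - P))).trace := by
      rw [hN, mul_assoc, mul_assoc, trace_mul_comm]
      simp only [mul_assoc]
    have e2 : (Δ * (Ξ * P)).trace = (Δ * (P * Ξ)).trace := by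
      rw [← mul_assoc, trace_mul_mul_comm_of_transpose_eq hΔT hΞT hPT, trace_mul_comm]
    rw [e1, e2, ← trace_add, ← trace_add, ← mul_add, ← mul_add]
    congr 2
    noncomm_ring
  set α := √A2 with hα
  have hα2 : α ^ 2 = A2 := Real.sq_sqrt hA2nn
  have hβ2 : √N2 ^ 2 = N2 := Real.sq_sqrt hN2nn
  have hγ2 : √Q ^ 2 = Q := Real.sq_sqrt hQnn
  set β := √N2
  set γ := √Q
  have hα0 : 0 ≤ α := Real.sqrt_nonneg _
  have h1 := (abs_le.1 hcs1).2
  have h2 := (abs_le.1 hcs2'').2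
  have h3 := (abs_le.1 hcs3).1
  have h3' := mul_le_mul_of_nonneg_left h3 hε
  have hWpos := mul_nonneg hε' hpos
  rw [hexp] at hWpos
  -- combine
  have hmain : (2 * (Δ * Δ).trace + ε' * (Δ * W * Δ).trace) / m2
      ≤ ε' * ((S₀ : Matrix V V ℝ) * W * S₀).trace / m2 + α * (4 * β + ε * γ) := by
    -- In the W-form, 2⟨Δ,S₁⟩ = ⟨Δ,Δ⟩ + ⟨S₁,S₁⟩ - ⟨S₀,S₀⟩. Discarding ⟨S₁,S₁⟩ ≥ 0 leaves the bias
    -- with coefficient exactly one.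
    have e1 : 2 * ((Δ * (S₁ : Matrix V V ℝ)).trace + ε' * (Δ * W * (S₁ : Matrix V V ℝ)).trace) / m2
        - 2 * (Δ * R).trace
        = (2 * (Δ * Δ).trace + ε' * (Δ * W * Δ).trace) / m2
          + (ε' * ((Δ * W * Δ).trace + 2 * (Δ * W * S₀).trace
              + ((S₀ : Matrix V V ℝ) * W * S₀).trace)) / m2
          - ε' * ((S₀ : Matrix V V ℝ) * W * S₀).trace / m2 - 2 * (Δ * Ξ).trace := by
      rw [hsplit1, hsplit2, hR]
      ring
    have e2 := div_nonneg hWpos hm2pos.le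
    rw [e1, hdecomp] at hvar
    rw [mul_add] at hnuc
    linarith
  -- Young's inequality; the term A2/m² is cancelled by the left side, where precisely the trace of
  -- Δ² over m² survives.
  have hfin : α * (4 * β + ε * γ) ≤ A2 / m2 + m2 * (8 * N2 + ε ^ 2 / 2 * Q) := by
    have e1 : α * (4 * β + ε * γ) ≤ α ^ 2 / m2 + m2 * (4 * β + ε * γ) ^ 2 / 4 := by
      have e2 : α ^ 2 / m2 + m2 * (4 * β + ε * γ) ^ 2 / 4 - α * (4 * β + ε * γ)
          = m2 * (α / m2 - (4 * β + ε * γ) / 2) ^ 2 := by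
        field_simp
        ring
      have e3 : 0 ≤ m2 * (α / m2 - (4 * β + ε * γ) / 2) ^ 2 := by positivity
      linarith
    have e4 : (4 * β + ε * γ) ^ 2 / 4 ≤ 8 * N2 + ε ^ 2 / 2 * Q := by
      rw [← hβ2, ← hγ2]
      nlinarith [sq_nonneg (4 * β - ε * γ)]
    have e5 := mul_le_mul_of_nonneg_left e4 hm2pos.le
    rw [hα2] at e1
    linarith
  have hA2' : A2 / m2 = ((Δ * Δ).trace + ε' * (Δ * W * Δ).trace) / m2 := by rw [hA2eq]
  have e6 : (2 * (Δ * Δ).trace + ε' * (Δ * W * Δ).trace) / m2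
      = (Δ * Δ).trace / m2 + ((Δ * Δ).trace + ε' * (Δ * W * Δ).trace) / m2 := by ring
  rw [← mul_div_assoc]
  linarith

end OracleInequality

/-! ### Weighted projection sums and the coherence function. -/

section Coherence

theorem le_coherence {V : Type*} [Fintype V] (L : Submodule ℝ (EuclideanSpace ℝ V))
    (φ : ℕ → EuclideanSpace ℝ V) {k t j : ℕ} (ht : 1 ≤ t) (htk : t ≤ k) (htj : t ≤ j)
    (hj : j ≤ Fintype.card V) :
    (t : ℝ) * ((1 / (j : ℝ)) * ∑ i ∈ Finset.Icc 1 j, ‖L.starProjection (φ i)‖ ^ 2)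
      ≤ coherence L φ k := by
  have h1 : (1 / (j : ℝ)) * ∑ i ∈ Finset.Icc 1 j, ‖L.starProjection (φ i)‖ ^ 2
      ≤ sSup ((fun j : ℕ => (1 / (j : ℝ)) * ∑ i ∈ Finset.Icc 1 j, ‖L.starProjection (φ i)‖ ^ 2) ''
        Set.Icc t (Fintype.card V)) :=
    le_csSup ((Set.finite_Icc _ _).image _).bddAbove ⟨j, ⟨htj, hj⟩, rfl⟩
  refine (mul_le_mul_of_nonneg_left h1 (Nat.cast_nonneg t)).trans ?_
  exact le_csSup ((Set.finite_Icc _ _).image _).bddAbove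
    ⟨t, ⟨ht, le_min htk (htj.trans hj)⟩, rfl⟩

/-- Summation by parts for weights `g` that are constant up to `s` and nonincreasing afterwards. -/
theorem sum_mul_le_of_partial_sums_le {a g : ℕ → ℝ} {b : ℝ} {s m : ℕ}
    (hF : ∀ j, s ≤ j → j ≤ m → ∑ i ∈ Finset.Icc 1 j, a i ≤ b * j)
    (hg1 : ∀ k, k ≤ s → g k = 1) (hg : ∀ k, s ≤ k → k + 1 ≤ m → g (k + 1) ≤ g k) (M : ℕ)
    (hsM : s ≤ M) : M ≤ m →
      ∑ i ∈ Finset.Icc 1 M, a i * g i ≤ (∑ i ∈ Finset.Icc 1 M, a i) * g M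
        + b * (s + ∑ k ∈ Finset.Icc (s + 1) M, g k - M * g M) := by
  induction M, hsM using Nat.le_induction with
  | base =>
    intro _
    rw [Finset.sum_mul, hg1 s le_rfl]
    have : ∑ i ∈ Finset.Icc 1 s, a i * g i = ∑ i ∈ Finset.Icc 1 s, a i * 1 :=
      Finset.sum_congr rfl fun i hi => by rw [hg1 i (Finset.mem_Icc.1 hi).2]
    rw [this]
    simp
  | succ M hM ih =>
    intro hMm
    have ih' := ih (by omega)
    rw [Finset.sum_Icc_succ_top (by omega), Finset.sum_Icc_succ_top (by omega),
      Finset.sum_Icc_succ_top (by omega)]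
    -- Passing from M to M + 1 increases the slack by (bM - ∑ a)(g M - g (M+1)), which is
    -- nonnegative.
    have h1 := mul_le_mul_of_nonneg_right (hF M hM (by omega)) (sub_nonneg.2 (hg M hM hMm))
    push_cast
    nlinarith

variable {V : Type*} [Fintype V] {W : Matrix V V ℝ} {lam : ℕ → ℝ} {φ : ℕ → EuclideanSpace ℝ V}
  {k₀ : ℕ} {c ζ : ℝ}

/-- Coherence at t = s bounds all partial sums of length j ≥ s by a multiple of j. Summation by
parts then trades the projections for the weights alone, whose total is at most s + cs by the tail
condition. -/
theorem sum_projection_div_le_coherence (L : Submodule ℝ (EuclideanSpace ℝ V)) (hc : 0 ≤ c)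
    (hspec : IsSpectralRepresentation W lam φ) (hreg : SpectrumRegular (Fintype.card V) lam k₀ c ζ)
    {s : ℕ} (hs : s ∈ Finset.Icc (k₀ + 1) (Fintype.card V + 1)) {ε' : ℝ} (hε0 : 0 ≤ ε')
    (hε' : invEigenvalue (Fintype.card V) lam s ≤ ε') :
    ∑ k ∈ Finset.Icc 1 (Fintype.card V), ‖L.starProjection (φ k)‖ ^ 2 / (1 + ε' * lam k)
      ≤ (1 + c) * coherence L φ s := by
  set m := Fintype.card V with hm
  obtain ⟨hs1, hs2⟩ := Finset.mem_Icc.1 hs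
  obtain ⟨⟨hk0, hk0pos⟩, -⟩ := hreg.isLeast
  obtain ⟨hk1, hk2⟩ := Finset.mem_Icc.1 hk0
  set a : ℕ → ℝ := fun k => ‖L.starProjection (φ k)‖ ^ 2 with ha
  have ha0 : ∀ k, 0 ≤ a k := fun k => by positivity
  have hden : ∀ k ∈ Finset.Icc 1 m, 1 ≤ 1 + ε' * lam k := fun k hk => by
    have := mul_nonneg hε0 (hspec.nonneg k hk); linarith
  -- When s = m + 1 there may be no decay, as ε' can be 0. The weights are then bounded by 1, and t
  -- = j = m in the coherence gives the whole sum.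
  rcases Nat.lt_or_ge m s with hsm | hsm
  · have h1 := le_coherence L φ (k := s) (t := m) (j := m) (by omega) (by omega) le_rfl le_rfl
    have hmpos : (0 : ℝ) < m := by exact_mod_cast (by omega : 0 < m)
    rw [← mul_assoc, mul_one_div_cancel hmpos.ne', one_mul] at h1
    have h2 : ∑ k ∈ Finset.Icc 1 m, a k / (1 + ε' * lam k) ≤ ∑ k ∈ Finset.Icc 1 m, a k :=
      Finset.sum_le_sum fun k hk => div_le_self (ha0 k) (hden k hk)
    have h3 : 0 ≤ coherence L φ s := (Finset.sum_nonneg fun k _ => ha0 k).trans h1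
    nlinarith [mul_nonneg hc h3]
  · have hspos : (0 : ℝ) < s := by exact_mod_cast (by omega : 0 < s)
    have hlampos : ∀ k, k₀ ≤ k → k ≤ m → 0 < lam k := fun k h1 h2 =>
      hk0pos.trans_le (hspec.mono k₀ hk0 k (Finset.mem_Icc.2 ⟨by omega, h2⟩) h1)
    have hls := hlampos s (by omega) hsm
    rw [invEigenvalue, if_pos hsm] at hε'
    set b := coherence L φ s / s with hb
    have hF : ∀ j, s ≤ j → j ≤ m → ∑ i ∈ Finset.Icc 1 j, a i ≤ b * j := by
      intro j h1 h2
      have h := le_coherence L φ (k := s) (t := s) (j := j) (by omega) le_rfl h1 h2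
      have hjpos : (0 : ℝ) < j := by exact_mod_cast (by omega : 0 < j)
      rw [hb, div_mul_eq_mul_div, le_div_iff₀ hspos]
      calc (∑ i ∈ Finset.Icc 1 j, a i) * s
          = (s * ((1 / (j : ℝ)) * ∑ i ∈ Finset.Icc 1 j, a i)) * j := by field_simp
        _ ≤ coherence L φ s * j := by gcongr
    have hb0 : 0 ≤ b := by
      have h := (Finset.sum_nonneg fun k _ => ha0 k).trans (hF s le_rfl hsm)
      exact nonneg_of_mul_nonneg_left h hspos
    -- From ε' ≥ 1/λ_s, the weight 1/(1+ε'λ_k) is at most λ_s/λ_k; it is used only beyond s, so that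
    -- `g` starts with a plateau at 1.
    set g : ℕ → ℝ := fun k => if k ≤ s then 1 else lam s / lam k with hg
    have hg1 : ∀ k, k ≤ s → g k = 1 := fun k hk => by simp [hg, hk]
    have hg2 : ∀ k, s < k → g k = lam s / lam k := fun k hk => by simp [hg, hk]
    have hganti : ∀ k, s ≤ k → k + 1 ≤ m → g (k + 1) ≤ g k := by
      intro k hk hkm
      have hmono := hspec.mono k (Finset.mem_Icc.2 ⟨by omega, by omega⟩) (k + 1)
        (Finset.mem_Icc.2 ⟨by omega, hkm⟩) (by omega)
      have hp := hlampos k (by omega) (by omega)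
      rw [hg2 (k + 1) (by omega)]
      rcases hk.eq_or_lt with h | h
      · subst h
        rw [hg1 s le_rfl]
        exact div_le_one_of_le₀ hmono (hp.le.trans hmono)
      · rw [hg2 k h]
        gcongr
    have hle : ∀ k ∈ Finset.Icc 1 m, a k / (1 + ε' * lam k) ≤ a k * g k := by
      intro k hk
      obtain ⟨hk1', hk2'⟩ := Finset.mem_Icc.1 hk
      rw [div_eq_mul_inv]
      refine mul_le_mul_of_nonneg_left ?_ (ha0 k)
      rcases le_or_gt k s with h | h
      · rw [hg1 k h]
        exact inv_le_one_of_one_le₀ (hden k hk)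
      · have hp := hlampos k (by omega) hk2'
        rw [hg2 k h, ← inv_div]
        refine inv_anti₀ (by positivity) ?_
        have := mul_le_mul_of_nonneg_right hε' hp.le
        rw [div_eq_inv_mul]
        linarith
    have habel := sum_mul_le_of_partial_sums_le hF hg1 hganti m hsm le_rfl
    have hgm : 0 ≤ g m := by
      rcases hsm.eq_or_lt with h | h
      · rw [hg1 m h.ge]; exact zero_le_one
      · rw [hg2 m h]
        exact div_nonneg hls.le (hlampos m (by omega) le_rfl).le
    have hFm := mul_le_mul_of_nonneg_right (hF m hsm le_rfl) hgm
    have hgsum : ∑ k ∈ Finset.Icc (s + 1) m, g k ≤ c * s := by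
      have h1 : ∑ k ∈ Finset.Icc (s + 1) m, g k = lam s * ∑ k ∈ Finset.Icc (s + 1) m, 1 / lam k := by
        rw [Finset.mul_sum]
        refine Finset.sum_congr rfl fun k hk => ?_
        rw [hg2 k (by have := (Finset.mem_Icc.1 hk).1; omega), mul_one_div]
      have h2 : ∑ k ∈ Finset.Icc (s + 1) m, 1 / lam k ≤ ∑ k ∈ Finset.Icc s m, 1 / lam k := by
        refine Finset.sum_le_sum_of_subset_of_nonneg
          (Finset.Icc_subset_Icc (by omega) le_rfl) fun k hk _ => ?_
        obtain ⟨h3, h4⟩ := Finset.mem_Icc.1 hk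
        exact (one_div_pos.2 (hlampos k (by omega) h4)).le
      have h3 := hreg.tail s (by omega) hsm
      rw [h1]
      calc lam s * ∑ k ∈ Finset.Icc (s + 1) m, 1 / lam k ≤ lam s * (c * (s / lam s)) := by
            gcongr; exact h2.trans h3
        _ = c * s := by field_simp
    have hbs : b * s = coherence L φ s := by rw [hb]; field_simp
    refine (Finset.sum_le_sum hle).trans (habel.trans ?_)
    have h4 := mul_le_mul_of_nonneg_left hgsum hb0
    rw [← hbs]
    nlinarith

end Coherence

/-! ### Reduction to a finite product law. -/

section SamplingLaw

open MeasureTheory ProbabilityTheory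

/-- The label `1` or `-1` encoded by a Boolean. -/
def boolLabel (b : Bool) : ℝ := if b then 1 else -1

/-- The probability mass function of a random triple `(X, X', Y)` with `X, X'` independent and
uniformly distributed and `E(Y | X = u, X' = v) = S u v`. -/
noncomputable def tripleLaw {V : Type*} [Fintype V] (S : SymKernel V) (τ : V × V × Bool) : ℝ :=
  (1 + boolLabel τ.2.2 * (S : Matrix V V ℝ) τ.1 τ.2.1) / (2 * (Fintype.card V : ℝ) ^ 2)

/-- The encoding of an observation as an element of a finite type. -/
noncomputable def encodeTriple {V : Type*} (o : V × V × ℝ) : V × V × Bool :=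
  (o.1, o.2.1, decide (o.2.2 = 1))

theorem measurable_encodeTriple {V : Type*} [MeasurableSpace V] :
    Measurable (encodeTriple : V × V × ℝ → V × V × Bool) := by
  have h : Measurable (fun y : ℝ => decide (y = 1)) :=
    measurable_to_bool (by
      have : (fun y : ℝ => decide (y = 1)) ⁻¹' {true} = {1} := by ext; simp
      rw [this]
      exact measurableSet_singleton _)
  exact measurable_fst.prodMk
    (measurable_snd.fst.prodMk (h.comp measurable_snd.snd))

variable {V Ω : Type*} [Fintype V] [MeasurableSpace V] [MeasurableSingletonClass V]
  [MeasurableSpace Ω] {μ : Measure Ω} {S : SymKernel V}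

theorem IsSimilarityTriple.measureReal_pair {X X' : Ω → V} {Y : Ω → ℝ}
    (h : IsSimilarityTriple μ S X X' Y) (u v : V) :
    μ.real {ω | X ω = u ∧ X' ω = v} = 1 / (Fintype.card V : ℝ) ^ 2 := by
  have huni : ∀ w : V, uniformOn (Set.univ : Set V) {w} = 1 / (Fintype.card V : ENNReal) := by
    intro w
    rw [uniformOn_univ, Measure.count_singleton]
  have hX : μ (X ⁻¹' {u}) = 1 / (Fintype.card V : ENNReal) := by
    rw [← huni u, ← h.uniform_left, Measure.map_apply h.measurable_left (measurableSet_singleton _)]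
  have hX' : μ (X' ⁻¹' {v}) = 1 / (Fintype.card V : ENNReal) := by
    rw [← huni v, ← h.uniform_right,
      Measure.map_apply h.measurable_right (measurableSet_singleton _)]
  have hset : {ω | X ω = u ∧ X' ω = v} = X ⁻¹' {u} ∩ X' ⁻¹' {v} := rfl
  rw [hset, Measure.real, h.indep.measure_inter_preimage_eq_mul _ _ (measurableSet_singleton _)
    (measurableSet_singleton _), hX, hX']
  simp [sq]

variable [IsProbabilityMeasure μ]

/-- Since Y = 2·1{Y = 1} - 1, the conditional mean fixes the conditional probability of Y = 1 on
each cell {X = u, X' = v}, and each cell has mass 1/m². -/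
theorem IsSimilarityTriple.measureReal_encode_eq {X X' : Ω → V} {Y : Ω → ℝ}
    (h : IsSimilarityTriple μ S X X' Y) (τ : V × V × Bool) :
    μ.real {ω | encodeTriple (X ω, X' ω, Y ω) = τ} = tripleLaw S τ := by
  obtain ⟨u, v, b⟩ := τ
  have hcard : (0 : ℝ) < Fintype.card V := by
    have : Nonempty V := ⟨u⟩
    exact_mod_cast Fintype.card_pos
  set E := {ω | X ω = u ∧ X' ω = v} with hE
  set F := {ω | Y ω = 1} with hF
  have hEm : MeasurableSet E :=
    (h.measurable_left (measurableSet_singleton u)).inter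
      (h.measurable_right (measurableSet_singleton v))
  have hFm : MeasurableSet F := h.measurable_label (measurableSet_singleton 1)
  have hEr := h.measureReal_pair u v
  rw [← hE] at hEr
  have hYind : ∀ ω, Y ω = 2 * F.indicator (fun _ => (1 : ℝ)) ω - 1 := by
    intro ω
    rcases h.label ω with h1 | h1
    · have : ω ∈ F := h1
      rw [Set.indicator_of_mem this, h1]; norm_num
    · have : ω ∉ F := by simp only [hF, Set.mem_ofPred_eq, h1]; norm_num
      rw [Set.indicator_of_notMem this, h1]; norm_num
  have hYint : ∫ ω in E, Y ω ∂μ = 2 * μ.real (E ∩ F) - μ.real E := by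
    simp_rw [hYind]
    rw [integral_sub, integral_const_mul, integral_indicator hFm]
    · simp only [integral_const, smul_eq_mul, mul_one]
      simp [Measure.restrict_restrict hFm, Set.inter_comm]
    · exact ((integrable_const 1).indicator hFm).const_mul 2
    · exact integrable_const 1
  have hreg := h.regression u v
  rw [← hE, ProbabilityTheory.cond, integral_smul_measure, hYint, ENNReal.toReal_inv,
    smul_eq_mul] at hreg
  have hEr' : (μ E).toReal = 1 / (Fintype.card V : ℝ) ^ 2 := hEr
  rw [hEr', hEr] at hreg
  have htrue : μ.real (E ∩ F)
      = (1 + (S : Matrix V V ℝ) u v) / (2 * (Fintype.card V : ℝ) ^ 2) := by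
    rw [← hreg]
    field_simp
    ring
  cases b with
  | true =>
    have hset : {ω | encodeTriple (X ω, X' ω, Y ω) = (u, v, true)} = E ∩ F := by
      ext ω
      simp [encodeTriple, hE, hF, and_assoc]
    rw [hset, htrue]
    simp [tripleLaw, boolLabel]
  | false =>
    have hset : {ω | encodeTriple (X ω, X' ω, Y ω) = (u, v, false)} = E \ F := by
      ext ω
      simp [encodeTriple, hE, hF, and_assoc]
    have hdiff := measureReal_sdiff_add_inter (μ := μ) (s := E) hFm
    rw [hset]
    have : μ.real (E \ F) = μ.real E - μ.real (E ∩ F) := by linarith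
    rw [this, hEr, htrue]
    simp only [tripleLaw, boolLabel]
    field_simp
    simp
    ring

/-- The formula is nonnegative because it is a probability. This is also the source of |S u v| ≤ 1.
-/
theorem IsSimilarityTriple.tripleLaw_nonneg {X X' : Ω → V} {Y : Ω → ℝ}
    (h : IsSimilarityTriple μ S X X' Y) (τ : V × V × Bool) : 0 ≤ tripleLaw S τ := by
  rw [← h.measureReal_encode_eq τ]
  exact measureReal_nonneg

/-- Independence turns every event of the encoded sample into the finite sum of products in which
the Bernstein bounds are phrased. -/
theorem IsSimilaritySample.measureReal_encode_mem {n : ℕ} {X X' : Fin n → Ω → V}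
    {Y : Fin n → Ω → ℝ} (h : IsSimilaritySample μ S X X' Y) (B : Finset (Fin n → V × V × Bool)) :
    MeasurableSet {ω | (fun j => encodeTriple (X j ω, X' j ω, Y j ω)) ∈ B} ∧
    μ.real {ω | (fun j => encodeTriple (X j ω, X' j ω, Y j ω)) ∈ B}
      = ∑ z ∈ B, ∏ j, tripleLaw S (z j) := by
  classical
  set Z : Fin n → Ω → V × V × Bool := fun j ω => encodeTriple (X j ω, X' j ω, Y j ω) with hZ
  have hindep : iIndepFun Z μ :=
    h.indep.comp (fun _ => encodeTriple) (fun _ => measurable_encodeTriple)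
  have hmeas : ∀ j, Measurable (Z j) := fun j =>
    measurable_encodeTriple.comp ((h.triple j).measurable_left.prodMk
      ((h.triple j).measurable_right.prodMk (h.triple j).measurable_label))
  have hsingle : ∀ z : Fin n → V × V × Bool,
      {ω | (fun j => Z j ω) = z} = ⋂ j ∈ Finset.univ, Z j ⁻¹' {z j} := by
    intro z
    ext ω
    simp [funext_iff]
  have hsm : ∀ z, MeasurableSet {ω | (fun j => Z j ω) = z} := by
    intro z
    rw [hsingle]
    exact Finset.measurableSet_biInter _ fun j _ => hmeas j (measurableSet_singleton _)
  have hprob : ∀ z, μ.real {ω | (fun j => Z j ω) = z} = ∏ j, tripleLaw S (z j) := by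
    intro z
    rw [hsingle, Measure.real,
      hindep.measure_inter_preimage_eq_mul Finset.univ (fun j _ => measurableSet_singleton _),
      ENNReal.toReal_prod]
    exact Finset.prod_congr rfl fun j _ => (h.triple j).measureReal_encode_eq (z j)
  have hunion : {ω | (fun j => Z j ω) ∈ B} = ⋃ z ∈ B, {ω | (fun j => Z j ω) = z} := by
    ext ω
    simp
  constructor
  · rw [hunion]
    exact Finset.measurableSet_biUnion _ fun z _ => hsm z
  · rw [hunion, measureReal_biUnion_finset]
    · exact Finset.sum_congr rfl fun z _ => hprob z
    · intro z _ z' _ hzz'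
      refine Set.disjoint_left.2 fun ω h1 h2 => hzz' ?_
      have h1' : (fun j => Z j ω) = z := h1
      exact h1'.symm.trans h2
    · exact fun z _ => hsm z

end SamplingLaw

/-! ### Size and variance of a single noise matrix. -/

section NoiseMoments

open Matrix

variable {V : Type*} [Fintype V] [DecidableEq V]

theorem symUnit_mulVec (u v : V) (w : V → ℝ) :
    symUnit u v *ᵥ w = (1 / 2 : ℝ) • (Pi.single u (w v) + Pi.single v (w u)) := by
  rw [symUnit, smul_mulVec, add_mulVec, single_mulVec, single_mulVec, one_mul, one_mul]
  rfl

theorem symUnit_mulVec_dotProduct_self (u v : V) (w : V → ℝ) :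
    (symUnit u v *ᵥ w) ⬝ᵥ (symUnit u v *ᵥ w)
      = (w u ^ 2 + w v ^ 2) / 4 + if u = v then w u ^ 2 / 2 else 0 := by
  rw [symUnit_mulVec]
  simp only [smul_dotProduct, dotProduct_smul, add_dotProduct, dotProduct_add, single_dotProduct,
    smul_eq_mul, Pi.single_eq_same]
  by_cases h : u = v
  · subst h
    simp
    ring
  · simp [h, Ne.symm h]
    ring

theorem symUnit_mulVec_dotProduct_self_le (u v : V) (w : V → ℝ) :
    (symUnit u v *ᵥ w) ⬝ᵥ (symUnit u v *ᵥ w) ≤ (w u ^ 2 + w v ^ 2) / 2 := by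
  rw [symUnit_mulVec_dotProduct_self]
  split_ifs with h
  · subst h
    linarith
  · nlinarith [sq_nonneg (w u), sq_nonneg (w v)]

theorem dotProduct_symUnit_mulVec (u v : V) (w : V → ℝ) :
    w ⬝ᵥ symUnit u v *ᵥ w = w u * w v := by
  rw [symUnit_mulVec, dotProduct_smul, dotProduct_add, dotProduct_single, dotProduct_single,
    smul_eq_mul]
  ring

/-- The generic formula over all pairs contributes m/2; the correction on the diagonal u = v
contributes the extra 1/2. -/
theorem sum_symUnit_mulVec_dotProduct_self (w : V → ℝ) :
    ∑ u, ∑ v, (symUnit u v *ᵥ w) ⬝ᵥ (symUnit u v *ᵥ w)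
      = ((Fintype.card V : ℝ) + 1) / 2 * (w ⬝ᵥ w) := by
  simp only [symUnit_mulVec_dotProduct_self, Finset.sum_add_distrib, ← Finset.sum_div,
    Finset.sum_ite_eq, Finset.mem_univ, if_true, Finset.sum_const, Finset.card_univ, nsmul_eq_mul,
    ← Finset.mul_sum]
  simp only [dotProduct, ← sq]
  ring

theorem sum_smul_symUnit (S : SymKernel V) :
    ∑ u, ∑ v, (S : Matrix V V ℝ) u v • symUnit u v = (S : Matrix V V ℝ) := by
  have hs : ∀ u v, (S : Matrix V V ℝ) v u = (S : Matrix V V ℝ) u v := fun u v =>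
    congrFun (congrFun S.transpose_eq u) v
  have h1 : ∑ u, ∑ v, (S : Matrix V V ℝ) u v • single u v (1 : ℝ) = (S : Matrix V V ℝ) := by
    conv_rhs => rw [matrix_eq_sum_single (S : Matrix V V ℝ)]
    simp only [smul_single, smul_eq_mul, mul_one]
  have h2 : ∑ u, ∑ v, (S : Matrix V V ℝ) u v • single v u (1 : ℝ) = (S : Matrix V V ℝ) := by
    rw [Finset.sum_comm]
    conv_rhs => rw [← h1]
    exact Finset.sum_congr rfl fun u _ => Finset.sum_congr rfl fun v _ => by rw [hs]
  have h3 : ∀ u v, (S : Matrix V V ℝ) u v • symUnit u v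
      = (1 / 2 : ℝ) • ((S : Matrix V V ℝ) u v • single u v (1 : ℝ)
        + (S : Matrix V V ℝ) u v • single v u (1 : ℝ)) := fun u v => by
    rw [symUnit, smul_comm, smul_add]
  simp only [h3, ← Finset.smul_sum, Finset.sum_add_distrib]
  rw [h1, h2, ← two_smul ℝ (S : Matrix V V ℝ), smul_smul]
  norm_num

/-- The symmetrized matrix of a single labelled observation. -/
noncomputable def signedUnit {V : Type*} [DecidableEq V] (τ : V × V × Bool) : Matrix V V ℝ :=
  boolLabel τ.2.2 • symUnit τ.1 τ.2.1

/-- The centered matrix of a single labelled observation. -/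
noncomputable def noiseMatrix (S : SymKernel V) (τ : V × V × Bool) : Matrix V V ℝ :=
  signedUnit τ - ((Fintype.card V : ℝ) ^ 2)⁻¹ • (S : Matrix V V ℝ)

theorem boolLabel_mul_self (b : Bool) : boolLabel b * boolLabel b = 1 := by
  cases b <;> simp [boolLabel]

theorem signedUnit_transpose {V : Type*} [DecidableEq V] (τ : V × V × Bool) :
    (signedUnit τ)ᵀ = signedUnit τ := by
  rw [signedUnit, transpose_smul, symUnit_transpose]

theorem noiseMatrix_transpose (S : SymKernel V) (τ : V × V × Bool) :
    (noiseMatrix S τ)ᵀ = noiseMatrix S τ := by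
  rw [noiseMatrix, transpose_sub, transpose_smul, signedUnit_transpose, S.transpose_eq]

theorem noiseMatrix_isHermitian (S : SymKernel V) (τ : V × V × Bool) :
    (noiseMatrix S τ).IsHermitian := by
  rw [IsHermitian, conjTranspose_eq_transpose_of_trivial, noiseMatrix_transpose]

theorem signedUnit_mulVec_dotProduct_self (τ : V × V × Bool) (w : V → ℝ) :
    (signedUnit τ *ᵥ w) ⬝ᵥ (signedUnit τ *ᵥ w)
      = (symUnit τ.1 τ.2.1 *ᵥ w) ⬝ᵥ (symUnit τ.1 τ.2.1 *ᵥ w) := by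
  rw [signedUnit, smul_mulVec, smul_dotProduct, dotProduct_smul, smul_smul, boolLabel_mul_self,
    one_smul]

theorem sum_tripleLaw_mul {V : Type*} [Fintype V] (S : SymKernel V) (f : V → V → ℝ) :
    ∑ τ, tripleLaw S τ * f τ.1 τ.2.1 = (∑ u, ∑ v, f u v) / (Fintype.card V : ℝ) ^ 2 := by
  rw [Fintype.sum_prod_type, Finset.sum_div]
  refine Finset.sum_congr rfl fun u _ => ?_
  rw [Fintype.sum_prod_type, Finset.sum_div]
  refine Finset.sum_congr rfl fun v _ => ?_
  rw [Fintype.sum_bool]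
  simp only [tripleLaw, boolLabel]
  simp
  ring

theorem sum_tripleLaw {V : Type*} [Fintype V] [Nonempty V] (S : SymKernel V) :
    ∑ τ, tripleLaw S τ = 1 := by
  have h := sum_tripleLaw_mul S (fun _ _ => 1)
  have hc : (Fintype.card V : ℝ) ≠ 0 := by exact_mod_cast Fintype.card_ne_zero
  simp only [mul_one, Finset.sum_const, Finset.card_univ, nsmul_eq_mul] at h
  rw [h]
  field_simp

theorem sum_tripleLaw_smul_signedUnit (S : SymKernel V) :
    ∑ τ, tripleLaw S τ • signedUnit τ
      = ((Fintype.card V : ℝ) ^ 2)⁻¹ • (S : Matrix V V ℝ) := by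
  rw [Fintype.sum_prod_type]
  conv_rhs => rw [← sum_smul_symUnit S]
  rw [Finset.smul_sum]
  refine Finset.sum_congr rfl fun u _ => ?_
  rw [Fintype.sum_prod_type, Finset.smul_sum]
  refine Finset.sum_congr rfl fun v _ => ?_
  rw [Fintype.sum_bool]
  simp only [tripleLaw, boolLabel, signedUnit, smul_smul, ← add_smul]
  congr 1
  simp
  ring

theorem sum_tripleLaw_smul_noiseMatrix [Nonempty V] (S : SymKernel V) :
    ∑ τ, tripleLaw S τ • noiseMatrix S τ = 0 := by
  simp only [noiseMatrix, smul_sub, Finset.sum_sub_distrib, sum_tripleLaw_smul_signedUnit,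
    ← Finset.sum_smul, sum_tripleLaw, one_smul, sub_self]

theorem sum_tripleLaw_mul_signedUnit (S : SymKernel V) (w : V → ℝ) :
    ∑ τ, tripleLaw S τ * ((signedUnit τ *ᵥ w) ⬝ᵥ (signedUnit τ *ᵥ w))
      = ((Fintype.card V : ℝ) + 1) / (2 * (Fintype.card V : ℝ) ^ 2) * (w ⬝ᵥ w) := by
  simp only [signedUnit_mulVec_dotProduct_self]
  rw [sum_tripleLaw_mul S (fun u v => (symUnit u v *ᵥ w) ⬝ᵥ (symUnit u v *ᵥ w)),
    sum_symUnit_mulVec_dotProduct_self]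
  field_simp

/-- Second moment equals variance plus squared mean. The equality serves twice: dropping the mean
bounds the variance, and dropping the variance bounds the mean. -/
theorem sum_tripleLaw_mul_noise_add [Nonempty V] (S : SymKernel V) (w : V → ℝ) :
    ∑ τ, tripleLaw S τ * ((noiseMatrix S τ *ᵥ w) ⬝ᵥ (noiseMatrix S τ *ᵥ w))
      + ((((Fintype.card V : ℝ) ^ 2)⁻¹ • (S : Matrix V V ℝ)) *ᵥ w)
        ⬝ᵥ ((((Fintype.card V : ℝ) ^ 2)⁻¹ • (S : Matrix V V ℝ)) *ᵥ w)
      = ((Fintype.card V : ℝ) + 1) / (2 * (Fintype.card V : ℝ) ^ 2) * (w ⬝ᵥ w) := by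
  set M := ((Fintype.card V : ℝ) ^ 2)⁻¹ • (S : Matrix V V ℝ) with hM
  have h1 := sum_tripleLaw_mul_signedUnit S w
  have h2 : ∑ τ, tripleLaw S τ * ((signedUnit τ *ᵥ w) ⬝ᵥ (M *ᵥ w)) = (M *ᵥ w) ⬝ᵥ (M *ᵥ w) := by
    have h := congrArg (fun B : Matrix V V ℝ => (B *ᵥ w) ⬝ᵥ (M *ᵥ w))
      (sum_tripleLaw_smul_signedUnit S)
    simp only [sum_mulVec, sum_dotProduct, smul_mulVec, smul_dotProduct, smul_eq_mul] at h
    rw [h, hM]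
    simp only [smul_mulVec, smul_dotProduct, smul_eq_mul]
  have h3 : ∀ τ, tripleLaw S τ * ((noiseMatrix S τ *ᵥ w) ⬝ᵥ (noiseMatrix S τ *ᵥ w))
      = tripleLaw S τ * ((signedUnit τ *ᵥ w) ⬝ᵥ (signedUnit τ *ᵥ w))
        - 2 * (tripleLaw S τ * ((signedUnit τ *ᵥ w) ⬝ᵥ (M *ᵥ w)))
        + tripleLaw S τ * ((M *ᵥ w) ⬝ᵥ (M *ᵥ w)) := fun τ => by
    rw [noiseMatrix, ← hM, sub_mulVec, sub_dotProduct, dotProduct_sub, dotProduct_sub,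
      dotProduct_comm (M *ᵥ w) (signedUnit τ *ᵥ w)]
    ring
  simp only [h3, Finset.sum_add_distrib, Finset.sum_sub_distrib, ← Finset.mul_sum,
    ← Finset.sum_mul, h1, h2, sum_tripleLaw]
  ring

theorem sum_tripleLaw_mul_noise_le [Nonempty V] (S : SymKernel V) (w : V → ℝ) :
    ∑ τ, tripleLaw S τ * ((noiseMatrix S τ *ᵥ w) ⬝ᵥ (noiseMatrix S τ *ᵥ w))
      ≤ ((Fintype.card V : ℝ) + 1) / (2 * (Fintype.card V : ℝ) ^ 2) * (w ⬝ᵥ w) := by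
  have h := sum_tripleLaw_mul_noise_add S w
  have h' := dotProduct_self_nonneg'
    ((((Fintype.card V : ℝ) ^ 2)⁻¹ • (S : Matrix V V ℝ)) *ᵥ w)
  linarith

theorem abs_apply_le_one_of_tripleLaw_nonneg {V : Type*} [Fintype V] [Nonempty V] {S : SymKernel V}
    (hp : ∀ τ, 0 ≤ tripleLaw S τ) (u v : V) : |(S : Matrix V V ℝ) u v| ≤ 1 := by
  have hc : (0 : ℝ) < 2 * (Fintype.card V : ℝ) ^ 2 := by
    have : (0 : ℝ) < Fintype.card V := by exact_mod_cast Fintype.card_pos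
    positivity
  have h1 := hp (u, v, true)
  have h2 := hp (u, v, false)
  simp only [tripleLaw, boolLabel, le_div_iff₀ hc, zero_mul] at h1 h2
  simp at h1 h2
  rw [abs_le]
  constructor <;> linarith

theorem abs_dotProduct_noiseMatrix_le [Nonempty V] {S : SymKernel V}
    (hp : ∀ τ, 0 ≤ tripleLaw S τ) (τ : V × V × Bool) (w : V → ℝ) :
    |w ⬝ᵥ noiseMatrix S τ *ᵥ w| ≤ (1 + 1 / (Fintype.card V : ℝ)) * (w ⬝ᵥ w) := by
  have hc : (0 : ℝ) < Fintype.card V := by exact_mod_cast Fintype.card_pos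
  have hww : w ⬝ᵥ w = ∑ i, w i ^ 2 := by simp only [dotProduct, sq]
  have h1 : |w ⬝ᵥ signedUnit τ *ᵥ w| ≤ w ⬝ᵥ w := by
    have hb : |boolLabel τ.2.2| = 1 := by cases τ.2.2 <;> simp [boolLabel]
    rw [signedUnit, smul_mulVec, dotProduct_smul, dotProduct_symUnit_mulVec, smul_eq_mul, abs_mul,
      hb, one_mul, hww]
    have ha := Finset.single_le_sum (f := fun i => w i ^ 2) (fun i _ => sq_nonneg _)
      (Finset.mem_univ τ.1)
    have hb := Finset.single_le_sum (f := fun i => w i ^ 2) (fun i _ => sq_nonneg _)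
      (Finset.mem_univ τ.2.1)
    rw [abs_le]
    constructor <;> nlinarith [sq_nonneg (w τ.1 - w τ.2.1), sq_nonneg (w τ.1 + w τ.2.1)]
  -- Entries are at most 1 in absolute value, so the form is at most (∑|w_u|)² ≤ m|w|²; the factor
  -- m⁻² then leaves 1/m.
  have h2 : |w ⬝ᵥ (S : Matrix V V ℝ) *ᵥ w| ≤ Fintype.card V * (w ⬝ᵥ w) := by
    calc |w ⬝ᵥ (S : Matrix V V ℝ) *ᵥ w|
        = |∑ u, ∑ v, w u * ((S : Matrix V V ℝ) u v * w v)| := by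
          simp only [dotProduct, mulVec, Finset.mul_sum]
      _ ≤ ∑ u, ∑ v, |w u| * |w v| := by
          refine (Finset.abs_sum_le_sum_abs _ _).trans (Finset.sum_le_sum fun u _ => ?_)
          refine (Finset.abs_sum_le_sum_abs _ _).trans (Finset.sum_le_sum fun v _ => ?_)
          rw [abs_mul, abs_mul]
          refine mul_le_mul_of_nonneg_left ?_ (abs_nonneg _)
          exact mul_le_of_le_one_left (abs_nonneg _) (abs_apply_le_one_of_tripleLaw_nonneg hp u v)
      _ = (∑ u, |w u|) ^ 2 := by rw [sq, Finset.sum_mul_sum]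
      _ ≤ Fintype.card V * (w ⬝ᵥ w) := by
          have := sq_sum_le_card_mul_sum_sq (s := Finset.univ) (f := fun u => |w u|)
          simpa [hww] using this
  rw [noiseMatrix, sub_mulVec, dotProduct_sub, smul_mulVec, dotProduct_smul, smul_eq_mul]
  refine (abs_sub _ _).trans ?_
  rw [abs_mul, abs_of_nonneg (by positivity : 0 ≤ ((Fintype.card V : ℝ) ^ 2)⁻¹)]
  have h3 := mul_le_mul_of_nonneg_left h2 (by positivity : 0 ≤ ((Fintype.card V : ℝ) ^ 2)⁻¹)
  have h4 : ((Fintype.card V : ℝ) ^ 2)⁻¹ * (Fintype.card V * (w ⬝ᵥ w))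
      = 1 / (Fintype.card V : ℝ) * (w ⬝ᵥ w) := by field_simp
  linarith

theorem sum_mulVec_dotProduct_self {V K : Type*} [Fintype V] [Fintype K] {φ : K → V → ℝ}
    (hφ : ∀ M : Matrix V V ℝ, M.trace = ∑ k, φ k ⬝ᵥ M *ᵥ φ k) (N : Matrix V V ℝ) :
    ∑ k, (N *ᵥ φ k) ⬝ᵥ (N *ᵥ φ k) = (Nᵀ * N).trace := by
  rw [hφ]
  refine Finset.sum_congr rfl fun k _ => ?_
  rw [← mulVec_mulVec, dotProduct_mulVec (φ k), vecMul_transpose]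

/-- A Hilbert–Schmidt norm does not depend on the orthonormal basis. In the canonical one, `N` acts
on the columns of `P`, where the leverages become visible. -/
theorem sum_mulVec_dotProduct_self_eq_sum_single {V K : Type*} [Fintype V] [Fintype K] {φ : K → V → ℝ}
    (hφ : ∀ M : Matrix V V ℝ, M.trace = ∑ k, φ k ⬝ᵥ M *ᵥ φ k) (N P : Matrix V V ℝ) :
    ∑ k, (N *ᵥ P *ᵥ φ k) ⬝ᵥ (N *ᵥ P *ᵥ φ k) = ∑ x, (N *ᵥ Pᵀ x) ⬝ᵥ (N *ᵥ Pᵀ x) := by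
  simp only [mulVec_mulVec]
  rw [sum_mulVec_dotProduct_self hφ, trace]
  refine Finset.sum_congr rfl fun x _ => ?_
  rw [diag_apply, mul_apply']
  rfl

theorem supportProj_diag_le_maxLeverage (S : SymKernel V) (v : V) :
    supportProj S v v ≤ maxLeverage (kernelSupport S) := by
  refine le_trans (le_of_eq ?_) (le_ciSup (f := fun v : V =>
    ‖(kernelSupport S).starProjection (EuclideanSpace.single v (1 : ℝ))‖ ^ 2)
    (Set.finite_range _).bddAbove v)
  simp only [norm_sq_kernelSupport_starProjection]
  simp [EuclideanSpace.single]

theorem sum_sq_supportProj_row (S : SymKernel V) (v : V) :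
    ∑ x, (supportProj S)ᵀ x v ^ 2 = supportProj S v v := by
  have h := congrFun (congrFun (supportProj_mul_self S) v) v
  rw [mul_apply] at h
  rw [← h]
  refine Finset.sum_congr rfl fun x _ => ?_
  have hx : supportProj S x v = supportProj S v x := congrFun (congrFun (supportProj_transpose S) v) x
  rw [transpose_apply, hx, sq]

theorem sum_signedUnit_supportProj_le {K : Type*} [Fintype K] {φ : K → V → ℝ}
    (hφ : ∀ M : Matrix V V ℝ, M.trace = ∑ k, φ k ⬝ᵥ M *ᵥ φ k) (S : SymKernel V)
    (τ : V × V × Bool) :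
    ∑ k, (signedUnit τ *ᵥ supportProj S *ᵥ φ k) ⬝ᵥ (signedUnit τ *ᵥ supportProj S *ᵥ φ k)
      ≤ maxLeverage (kernelSupport S) := by
  rw [sum_mulVec_dotProduct_self_eq_sum_single hφ]
  simp only [signedUnit_mulVec_dotProduct_self]
  refine (Finset.sum_le_sum fun x _ => symUnit_mulVec_dotProduct_self_le _ _ _).trans ?_
  rw [← Finset.sum_div, Finset.sum_add_distrib, sum_sq_supportProj_row, sum_sq_supportProj_row]
  have h1 := supportProj_diag_le_maxLeverage S τ.1
  have h2 := supportProj_diag_le_maxLeverage S τ.2.1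
  linarith

/-- The factor 4 is 2 + 2 from |a-b|² ≤ 2|a|² + 2|b|²; the mean obeys the same leverage bound as the
signed unit by Jensen. -/
theorem sum_noiseMatrix_supportProj_le [Nonempty V] {K : Type*} [Fintype K] {φ : K → V → ℝ}
    (hφ : ∀ M : Matrix V V ℝ, M.trace = ∑ k, φ k ⬝ᵥ M *ᵥ φ k) {S : SymKernel V}
    (hp : ∀ τ, 0 ≤ tripleLaw S τ) (τ : V × V × Bool) :
    ∑ k, (noiseMatrix S τ *ᵥ supportProj S *ᵥ φ k) ⬝ᵥ (noiseMatrix S τ *ᵥ supportProj S *ᵥ φ k)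
      ≤ 4 * maxLeverage (kernelSupport S) := by
  set M := ((Fintype.card V : ℝ) ^ 2)⁻¹ • (S : Matrix V V ℝ) with hM
  have h1 : ∀ w : V → ℝ, (noiseMatrix S τ *ᵥ w) ⬝ᵥ (noiseMatrix S τ *ᵥ w)
      ≤ 2 * ((signedUnit τ *ᵥ w) ⬝ᵥ (signedUnit τ *ᵥ w)) + 2 * ((M *ᵥ w) ⬝ᵥ (M *ᵥ w)) := by
    intro w
    have h := dotProduct_self_nonneg' (signedUnit τ *ᵥ w + M *ᵥ w)
    rw [add_dotProduct, dotProduct_add, dotProduct_add] at h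
    rw [noiseMatrix, ← hM, sub_mulVec, sub_dotProduct, dotProduct_sub, dotProduct_sub]
    linarith
  have h2 : ∀ w : V → ℝ, (M *ᵥ w) ⬝ᵥ (M *ᵥ w)
      ≤ ∑ τ, tripleLaw S τ * ((signedUnit τ *ᵥ w) ⬝ᵥ (signedUnit τ *ᵥ w)) := by
    intro w
    have h := sum_tripleLaw_mul_noise_add S w
    have h0 : 0 ≤ ∑ τ, tripleLaw S τ * ((noiseMatrix S τ *ᵥ w) ⬝ᵥ (noiseMatrix S τ *ᵥ w)) :=
      Finset.sum_nonneg fun τ _ => mul_nonneg (hp τ) (dotProduct_self_nonneg' _)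
    rw [sum_tripleLaw_mul_signedUnit]
    linarith
  have h4 : ∑ k, (M *ᵥ supportProj S *ᵥ φ k) ⬝ᵥ (M *ᵥ supportProj S *ᵥ φ k)
      ≤ maxLeverage (kernelSupport S) := by
    refine (Finset.sum_le_sum fun k _ => h2 _).trans ?_
    rw [Finset.sum_comm]
    simp only [← Finset.mul_sum]
    refine (Finset.sum_le_sum fun τ _ => mul_le_mul_of_nonneg_left
      (sum_signedUnit_supportProj_le hφ S τ) (hp τ)).trans ?_
    rw [← Finset.sum_mul, sum_tripleLaw, one_mul]
  refine (Finset.sum_le_sum fun k _ => h1 _).trans ?_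
  rw [Finset.sum_add_distrib, ← Finset.mul_sum, ← Finset.mul_sum]
  have h5 := sum_signedUnit_supportProj_le hφ S τ
  linarith

theorem maxLeverage_pos (S : SymKernel V) (hS : (S : Matrix V V ℝ) ≠ 0) :
    0 < maxLeverage (kernelSupport S) := by
  by_contra! hcon
  apply hS
  have hzero : supportProj S = 0 := by
    ext v x
    have h1 := sum_sq_supportProj_row S v
    have h2 := (supportProj_diag_le_maxLeverage S v).trans hcon
    have h3 : ∑ x, (supportProj S)ᵀ x v ^ 2 = 0 :=
      le_antisymm (h1.trans_le h2) (Finset.sum_nonneg fun x _ => sq_nonneg _)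
    have h4 := (Finset.sum_eq_zero_iff_of_nonneg fun x _ => sq_nonneg _).1 h3 x (Finset.mem_univ x)
    exact pow_eq_zero_iff (two_ne_zero) |>.1 h4
  rw [← supportProj_mul S, hzero, zero_mul]

end NoiseMoments

/-! ### Tail bounds for the noise, in operator form and on the support. -/

section NoiseTails

open Matrix

variable {V : Type*} [Fintype V] [DecidableEq V]

theorem noise_operator_tail [Nonempty V] {S : SymKernel V} (hp : ∀ τ, 0 ≤ tripleLaw S τ)
    (hm : 2 ≤ Fintype.card V) {τ₀ : ℝ} (hτ₀ : 0 < τ₀) {n : ℕ} (hn : Fintype.card V * τ₀ ≤ n)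
    (B : Finset (Fin n → V × V × Bool))
    (hB : ∀ z ∈ B, ∃ w, 2 * √(τ₀ / (n * Fintype.card V)) * (w ⬝ᵥ w)
      < |w ⬝ᵥ ((1 / n : ℝ) • ∑ j, noiseMatrix S (z j)) *ᵥ w|) :
    ∑ z ∈ B, ∏ j, tripleLaw S (z j) ≤ 2 * Fintype.card V * Real.exp (-(5 / 4 * τ₀)) := by
  classical
  set m := (Fintype.card V : ℝ) with hmdef
  have hm2 : (2 : ℝ) ≤ m := by rw [hmdef]; exact_mod_cast hm
  have hmpos : 0 < m := by linarith
  have hnpos : (0 : ℝ) < n := (mul_pos hmpos hτ₀).trans_le hn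
  set θ := √(m * τ₀ / n) with hθ
  have hθ0 : 0 ≤ θ := Real.sqrt_nonneg _
  have hθsq : θ ^ 2 = m * τ₀ / n := Real.sq_sqrt (by positivity)
  have hθ1 : θ ≤ 1 := by
    rw [hθ]
    exact Real.sqrt_le_one.2 ((div_le_one hnpos).2 hn)
  set x := n * (2 * √(τ₀ / (n * m))) with hx
  have hU : 1 + 1 / m ≤ 3 / 2 := by
    have : 1 / m ≤ 1 / 2 := by gcongr
    linarith
  have hθU : θ * (1 + 1 / m) ≤ 3 / 2 :=
    (mul_le_of_le_one_left (by positivity) hθ1).trans hU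
  have hθx : θ * x = 2 * τ₀ := by
    have h1 : θ * √(τ₀ / (n * m)) = τ₀ / n := by
      rw [hθ, ← Real.sqrt_mul (by positivity)]
      have : m * τ₀ / n * (τ₀ / (n * m)) = (τ₀ / n) ^ 2 := by field_simp
      rw [this, Real.sqrt_sq (by positivity)]
    calc θ * x = n * 2 * (θ * √(τ₀ / (n * m))) := by rw [hx]; ring
      _ = 2 * τ₀ := by rw [h1]; field_simp
  -- The variance term is (1 + 1/m)τ₀/2 ≤ 3τ₀/4 because m ≥ 2, and θx = 2τ₀; the difference is
  -- -5τ₀/4.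
  have hexpo : n * (θ ^ 2 * ((m + 1) / (2 * m ^ 2))) - θ * x ≤ -(5 / 4 * τ₀) := by
    rw [hθx, hθsq]
    have h1 : (n : ℝ) * (m * τ₀ / n * ((m + 1) / (2 * m ^ 2))) = (1 + 1 / m) / 2 * τ₀ := by
      field_simp
    rw [h1]
    nlinarith
  have hneg : ∀ z : Fin n → V × V × Bool,
      ∑ j, -noiseMatrix S (z j) = -∑ j, noiseMatrix S (z j) := fun z => by
    rw [Finset.sum_neg_distrib]
  have hcover : ∀ z ∈ B, (∃ w, x * (w ⬝ᵥ w) < w ⬝ᵥ (∑ j, noiseMatrix S (z j)) *ᵥ w) ∨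
      ∃ w, x * (w ⬝ᵥ w) < w ⬝ᵥ (∑ j, -noiseMatrix S (z j)) *ᵥ w := by
    intro z hz
    obtain ⟨w, hw⟩ := hB z hz
    rw [smul_mulVec, dotProduct_smul, smul_eq_mul, abs_mul, abs_of_pos (by positivity),
      one_div, ← div_eq_inv_mul, lt_div_iff₀ hnpos] at hw
    have hw' : x * (w ⬝ᵥ w) < |w ⬝ᵥ (∑ j, noiseMatrix S (z j)) *ᵥ w| := by
      rw [hx]
      linarith
    rcases lt_abs.1 hw' with h | h
    · exact Or.inl ⟨w, h⟩
    · refine Or.inr ⟨w, ?_⟩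
      rwa [hneg, neg_mulVec, dotProduct_neg]
  set B₁ := B.filter fun z => ∃ w, x * (w ⬝ᵥ w) < w ⬝ᵥ (∑ j, noiseMatrix S (z j)) *ᵥ w
  set B₂ := B.filter fun z => ∃ w, x * (w ⬝ᵥ w) < w ⬝ᵥ (∑ j, -noiseMatrix S (z j)) *ᵥ w
  have hsub : B ⊆ B₁ ∪ B₂ := fun z hz => by
    rw [← Finset.filter_or, Finset.mem_filter]
    exact ⟨hz, hcover z hz⟩
  have hprod : ∀ z : Fin n → V × V × Bool, 0 ≤ ∏ j, tripleLaw S (z j) := fun z =>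
    Finset.prod_nonneg fun j _ => hp _
  have h1 := matrix_bernstein (tripleLaw S) hp (sum_tripleLaw S) (noiseMatrix S)
    (noiseMatrix_isHermitian S) (sum_tripleLaw_smul_noiseMatrix S) (x := x)
    (abs_dotProduct_noiseMatrix_le hp) hθ0 hθU (sum_tripleLaw_mul_noise_le S) n B₁
    (fun z hz => (Finset.mem_filter.1 hz).2)
  have h2 := matrix_bernstein (tripleLaw S) hp (sum_tripleLaw S) (fun τ => -noiseMatrix S τ)
    (fun τ => (noiseMatrix_isHermitian S τ).neg)
    (by simp only [smul_neg, Finset.sum_neg_distrib, sum_tripleLaw_smul_noiseMatrix, neg_zero])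
    (x := x) (U := 1 + 1 / m) (σ := (m + 1) / (2 * m ^ 2))
    (fun τ w => by
      rw [neg_mulVec, dotProduct_neg, abs_neg]
      exact abs_dotProduct_noiseMatrix_le hp τ w) hθ0 hθU
    (fun w => by
      simp only [neg_mulVec, dotProduct_neg, neg_dotProduct, neg_neg]
      exact sum_tripleLaw_mul_noise_le S w) n B₂
    (fun z hz => (Finset.mem_filter.1 hz).2)
  have h3 : m * Real.exp (n * (θ ^ 2 * ((m + 1) / (2 * m ^ 2))) - θ * x)
      ≤ m * Real.exp (-(5 / 4 * τ₀)) := by gcongr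
  calc ∑ z ∈ B, ∏ j, tripleLaw S (z j)
      ≤ ∑ z ∈ B₁ ∪ B₂, ∏ j, tripleLaw S (z j) :=
        Finset.sum_le_sum_of_subset_of_nonneg hsub fun z _ _ => hprod z
    _ ≤ ∑ z ∈ B₁, ∏ j, tripleLaw S (z j) + ∑ z ∈ B₂, ∏ j, tripleLaw S (z j) := by
        rw [← Finset.sum_union_inter]
        exact le_add_of_nonneg_right (Finset.sum_nonneg fun z _ => hprod z)
    _ ≤ 2 * m * Real.exp (-(5 / 4 * τ₀)) := by
        have e1 := h1.trans h3
        have e2 := h2.trans h3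
        linarith

/-- The images of the vectors `ψ k` under a matrix, scaled by `1 / √(a k)`, as a single vector. -/
noncomputable def scaledImages {V K : Type*} [Fintype V] (a : K → ℝ) (ψ : K → V → ℝ)
    (A : Matrix V V ℝ) : V × K → ℝ :=
  fun x => (√(a x.2))⁻¹ * (A *ᵥ ψ x.2) x.1

theorem scaledImages_dotProduct_self {V K : Type*} [Fintype V] [Fintype K] {a : K → ℝ}
    (ha : ∀ k, 0 < a k) (ψ : K → V → ℝ) (A : Matrix V V ℝ) :
    scaledImages a ψ A ⬝ᵥ scaledImages a ψ A = ∑ k, (A *ᵥ ψ k) ⬝ᵥ (A *ᵥ ψ k) / a k := by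
  simp only [dotProduct, scaledImages]
  rw [Fintype.sum_prod_type_right]
  refine Finset.sum_congr rfl fun k _ => ?_
  rw [Finset.sum_div]
  refine Finset.sum_congr rfl fun v _ => ?_
  have h : (√(a k))⁻¹ * (√(a k))⁻¹ = (a k)⁻¹ := by
    rw [← mul_inv, Real.mul_self_sqrt (ha k).le]
  rw [div_eq_mul_inv, ← h]
  ring

theorem scaledImages_sum {V K ι : Type*} [Fintype V] (a : K → ℝ) (ψ : K → V → ℝ)
    (s : Finset ι) (q : ι → ℝ) (A : ι → Matrix V V ℝ) :
    ∑ i ∈ s, q i • scaledImages a ψ (A i) = scaledImages a ψ (∑ i ∈ s, q i • A i) := by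
  ext x
  simp only [scaledImages, Finset.sum_apply, Pi.smul_apply, smul_eq_mul, sum_mulVec, smul_mulVec,
    Finset.mul_sum]
  exact Finset.sum_congr rfl fun i _ => by ring

/-- The weighted sum is the squared length of `scaledImages`, a sum of independent centered vectors
in dimension |V||K|. Its variance proxy is Q/m because (m+1)/(2m²) ≤ 1/m, and each summand has
squared length at most 4L, L being the maximal leverage. -/
theorem noise_support_tail [Nonempty V] {S : SymKernel V} (hp : ∀ τ, 0 ≤ tripleLaw S τ)
    (hS : (S : Matrix V V ℝ) ≠ 0) {K : Type*} [Fintype K] [DecidableEq K] {φ : K → V → ℝ}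
    (hφ : ∀ M : Matrix V V ℝ, M.trace = ∑ k, φ k ⬝ᵥ M *ᵥ φ k) {a : K → ℝ} (ha : ∀ k, 1 ≤ a k)
    {T : ℝ} (hT : 0 < T) {n : ℕ} (hn : 0 < n) {Q : ℝ}
    (hQ : Q = ∑ k, φ k ⬝ᵥ supportProj S *ᵥ φ k / a k)
    (B : Finset (Fin n → V × V × Bool))
    (hB : ∀ z ∈ B, 50 * (Q * T / (n * Fintype.card V)
        + 4 * maxLeverage (kernelSupport S) * T ^ 2 / n ^ 2)
      < ∑ k, (((1 / n : ℝ) • ∑ j, noiseMatrix S (z j)) *ᵥ supportProj S *ᵥ φ k)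
          ⬝ᵥ (((1 / n : ℝ) • ∑ j, noiseMatrix S (z j)) *ᵥ supportProj S *ᵥ φ k) / a k) :
    ∑ z ∈ B, ∏ j, tripleLaw S (z j)
      ≤ (Fintype.card V * Fintype.card K + 1) * Real.exp (-(4 * T)) := by
  set m := (Fintype.card V : ℝ) with hmdef
  have hm1 : (1 : ℝ) ≤ m := by rw [hmdef]; exact_mod_cast Fintype.card_pos
  have hmpos : 0 < m := by linarith
  have hnpos : (0 : ℝ) < n := by exact_mod_cast hn
  have hapos : ∀ k, 0 < a k := fun k => one_pos.trans_le (ha k)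
  set L := maxLeverage (kernelSupport S)
  have hL : 0 < L := maxLeverage_pos S hS
  have hQ0 : 0 ≤ Q := by
    rw [hQ]
    refine Finset.sum_nonneg fun k _ => div_nonneg ?_ (hapos k).le
    rw [← supportProj_mulVec_dotProduct_self]
    exact dotProduct_self_nonneg' _
  set ψ : K → V → ℝ := fun k => supportProj S *ᵥ φ k with hψ
  have hq0 : 0 ≤ n * Q * T / m := by positivity
  have hsq1 := Real.sq_sqrt hq0
  have hsq2 := Real.sq_sqrt hL.le
  have hs1 : 0 ≤ √(n * Q * T / m) := Real.sqrt_nonneg _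
  have hs2 : 0 < √L := Real.sqrt_pos.2 hL
  -- r adds the Gaussian and the bounded scale. With θ = T/r and threshold 5r the exponent is at
  -- most T - 5T = -4T.
  set r := √(n * Q * T / m) + 2 * √L * T with hr
  have hr0 : 0 < r := by positivity
  set θ := T / r with hθ
  have hθ0 : 0 ≤ θ := by positivity
  have hθU : θ * (2 * √L) ≤ 3 / 2 := by
    rw [hθ, div_mul_eq_mul_div, div_le_iff₀ hr0]
    have : T * (2 * √L) ≤ r := by rw [hr]; linarith
    linarith
  have hexpo : n * (θ ^ 2 * (Q / m)) - θ * (5 * r) ≤ -(4 * T) := by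
    have h1 : θ * (5 * r) = 5 * T := by rw [hθ]; field_simp
    have h2 : n * (θ ^ 2 * (Q / m)) ≤ T := by
      have h3 : n * (θ ^ 2 * (Q / m)) = T * (n * Q * T / m) / r ^ 2 := by
        rw [hθ]; field_simp
      rw [h3, div_le_iff₀ (by positivity)]
      refine mul_le_mul_of_nonneg_left ?_ hT.le
      rw [← hsq1]
      exact pow_le_pow_left₀ hs1 (by rw [hr]; linarith [mul_pos hs2 hT]) 2
    rw [h1]
    linarith
  have h := vector_bernstein (tripleLaw S) hp (sum_tripleLaw S)
    (fun τ => scaledImages a ψ (noiseMatrix S τ)) ?_ (U := 2 * √L) (σ := Q / m) (x := 5 * r)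
    (by positivity) ?_ hθ0 hθU ?_ (by positivity) n B ?_
  · refine h.trans ?_
    rw [Fintype.card_prod]
    push_cast
    gcongr
  · rw [scaledImages_sum, sum_tripleLaw_smul_noiseMatrix]
    ext x
    simp [scaledImages]
  · intro τ
    rw [scaledImages_dotProduct_self hapos]
    refine (Finset.sum_le_sum fun k _ => div_le_self (dotProduct_self_nonneg' _) (ha k)).trans ?_
    refine (sum_noiseMatrix_supportProj_le hφ hp τ).trans (le_of_eq ?_)
    rw [mul_pow, hsq2]
    norm_num
    rfl
  · simp only [scaledImages_dotProduct_self hapos, Finset.mul_sum]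
    rw [Finset.sum_comm, hQ, Finset.sum_div]
    refine Finset.sum_le_sum fun k _ => ?_
    have h1 := sum_tripleLaw_mul_noise_le S (ψ k)
    simp only [← mul_div_assoc]
    rw [← Finset.sum_div, div_right_comm]
    refine div_le_div_of_nonneg_right (h1.trans ?_) (hapos k).le
    rw [hψ, supportProj_mulVec_dotProduct_self]
    have h2 : 0 ≤ φ k ⬝ᵥ supportProj S *ᵥ φ k := by
      rw [← supportProj_mulVec_dotProduct_self]
      exact dotProduct_self_nonneg' _
    rw [div_eq_inv_mul _ m]
    refine mul_le_mul_of_nonneg_right ?_ h2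
    rw [← hmdef, div_le_iff₀ (by positivity)]
    have : m⁻¹ * (2 * m ^ 2) = 2 * m := by field_simp
    rw [this]
    linarith
  · intro z hz
    have h1 := hB z hz
    have h2 : ∑ j, scaledImages a ψ (noiseMatrix S (z j))
        = scaledImages a ψ (∑ j, noiseMatrix S (z j)) := by
      have := scaledImages_sum a ψ Finset.univ (fun _ : Fin n => (1 : ℝ))
        (fun j => noiseMatrix S (z j))
      simpa using this
    rw [h2, scaledImages_dotProduct_self hapos]
    have h3 : ∑ k, (((1 / n : ℝ) • ∑ j, noiseMatrix S (z j)) *ᵥ supportProj S *ᵥ φ k)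
          ⬝ᵥ (((1 / n : ℝ) • ∑ j, noiseMatrix S (z j)) *ᵥ supportProj S *ᵥ φ k) / a k
        = (∑ k, ((∑ j, noiseMatrix S (z j)) *ᵥ ψ k) ⬝ᵥ ((∑ j, noiseMatrix S (z j)) *ᵥ ψ k) / a k)
          / n ^ 2 := by
      rw [Finset.sum_div]
      refine Finset.sum_congr rfl fun k _ => ?_
      rw [smul_mulVec, smul_dotProduct, dotProduct_smul, smul_eq_mul, smul_eq_mul]
      field_simp
      rfl
    rw [h3, lt_div_iff₀ (by positivity)] at h1
    refine lt_of_le_of_lt ?_ h1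
    have h4 : 50 * (Q * T / (n * m) + 4 * L * T ^ 2 / n ^ 2) * n ^ 2
        = 50 * (n * Q * T / m + 4 * L * T ^ 2) := by field_simp
    rw [h4, ← hsq1, ← hsq2, hr]
    -- The constant 50 arises from 25(a+b)² ≤ 50(a²+b²).
    nlinarith [sq_nonneg (√(n * Q * T / m) - 2 * √L * T)]

end NoiseTails

/-! ### Completeness of the eigenbasis of W. -/

section SpectralRepresentation

open Matrix

variable {V : Type*} [Fintype V] {W : Matrix V V ℝ} {lam : ℕ → ℝ} {φ : ℕ → EuclideanSpace ℝ V}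

theorem IsSpectralRepresentation.dotProduct_eq_ite (h : IsSpectralRepresentation W lam φ)
    (j k : Finset.Icc 1 (Fintype.card V)) :
    (φ j).ofLp ⬝ᵥ (φ k).ofLp = if j = k then 1 else 0 := by
  have h1 := orthonormal_iff_ite.1 h.orthonormal k j
  rw [EuclideanSpace.inner_eq_star_dotProduct] at h1
  simp only [star_trivial] at h1
  rw [h1]
  simp only [eq_comm]

theorem IsSpectralRepresentation.trace_eq [DecidableEq V] (h : IsSpectralRepresentation W lam φ)
    (M : Matrix V V ℝ) :
    M.trace = ∑ k : Finset.Icc 1 (Fintype.card V), (φ k).ofLp ⬝ᵥ M *ᵥ (φ k).ofLp := by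
  set Φ : Matrix V (Finset.Icc 1 (Fintype.card V)) ℝ := Matrix.of fun v k => (φ k).ofLp v with hΦ
  have h1 : Φᵀ * Φ = 1 := by
    ext j k
    rw [mul_apply', one_apply]
    exact h.dotProduct_eq_ite j k
  -- The index set has exactly as many elements as V, so orthonormal columns already form a basis.
  have h2 : Φ * Φᵀ = 1 := by
    refine (mul_eq_one_comm_of_card_eq _ _ _ ?_).1 h1
    simp
  calc M.trace = (M * (Φ * Φᵀ)).trace := by rw [h2, mul_one]
    _ = (Φᵀ * (M * Φ)).trace := by rw [← Matrix.mul_assoc, trace_mul_comm]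
    _ = _ := by
      rw [trace]
      refine Finset.sum_congr rfl fun k _ => ?_
      rw [diag_apply, mul_apply']
      rfl

theorem IsSpectralRepresentation.posSemidef (h : IsSpectralRepresentation W lam φ) :
    W.PosSemidef := by
  rw [h.eq_sum]
  refine posSemidef_sum _ fun k hk => ?_
  refine PosSemidef.smul ?_ (h.nonneg k hk)
  have := posSemidef_vecMulVec_self_star (φ k).ofLp
  simpa using this

theorem IsSpectralRepresentation.mulVec_eq (h : IsSpectralRepresentation W lam φ)
    (k : Finset.Icc 1 (Fintype.card V)) : W *ᵥ (φ k).ofLp = lam k • (φ k).ofLp := by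
  have h1 : W = ∑ j : Finset.Icc 1 (Fintype.card V), lam j • vecMulVec (φ j).ofLp (φ j).ofLp := by
    rw [h.eq_sum, ← Finset.sum_coe_sort]
  conv_lhs => rw [h1]
  rw [sum_mulVec, Finset.sum_eq_single k]
  · rw [smul_mulVec, vecMulVec_mulVec, h.dotProduct_eq_ite]
    simp
  · intro j _ hj
    rw [smul_mulVec, vecMulVec_mulVec, h.dotProduct_eq_ite, if_neg hj]
    simp
  · simp

end SpectralRepresentation

/-! ### Probability budget and assembly of the bound. -/

section MainBound

open Matrix MeasureTheory

theorem boolLabel_decide {y : ℝ} (hy : y = 1 ∨ y = -1) : boolLabel (decide (y = 1)) = y := by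
  rcases hy with rfl | rfl
  · simp [boolLabel]
  · have : ¬((-1 : ℝ) = 1) := by norm_num
    simp [boolLabel, this]

theorem sum_noiseMatrix_eq {V : Type*} [Fintype V] [DecidableEq V] (S : SymKernel V) {n : ℕ}
    (hn : 0 < n) (x x' : Fin n → V) {y : Fin n → ℝ} (hy : ∀ j, y j = 1 ∨ y j = -1) :
    (1 / n : ℝ) • ∑ j, noiseMatrix S (encodeTriple (x j, x' j, y j))
      = empiricalKernel x x' y - ((Fintype.card V : ℝ) ^ 2)⁻¹ • (S : Matrix V V ℝ) := by
  have hn' : (n : ℝ) ≠ 0 := by exact_mod_cast hn.ne'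
  simp only [noiseMatrix, Finset.sum_sub_distrib, smul_sub, Finset.sum_const, Finset.card_univ,
    Fintype.card_fin, empiricalKernel, signedUnit, encodeTriple, boolLabel_decide (hy _)]
  congr 1
  rw [← Nat.cast_smul_eq_nsmul ℝ, smul_smul, one_div, inv_mul_cancel₀ hn', one_smul]

/-- Covers m = 1, where the operator tail bound is not available: the support is the whole space and
there is no noise off it. -/
theorem one_sub_supportProj_eq_zero {V : Type*} [Fintype V] [DecidableEq V] (S : SymKernel V)
    (hS : (S : Matrix V V ℝ) ≠ 0) (hV : Fintype.card V ≤ 1) : 1 - supportProj S = 0 := by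
  have : Subsingleton V := Fintype.card_le_one_iff_subsingleton.1 hV
  ext u v
  obtain rfl := Subsingleton.elim u v
  have hne : (S : Matrix V V ℝ) u u ≠ 0 := by
    intro h
    apply hS
    ext a b
    rw [Subsingleton.elim a u, Subsingleton.elim b u, h, Matrix.zero_apply]
  have h1 := congrFun (congrFun (supportProj_mul S) u) u
  rw [mul_apply, Fintype.sum_subsingleton _ u] at h1
  have h2 : supportProj S u u = 1 := mul_right_cancel₀ hne (by rw [h1, one_mul])
  simp [h2]

variable {t ζ : ℝ} {n m : ℕ}

theorem pos_of_mul_tnm_le (ht : 0 < t) (hζ : 1 ≤ ζ) (hm : 1 ≤ m) (h : m * tnm t ζ n m ≤ n) :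
    0 < n := by
  by_contra! h0
  obtain rfl : n = 0 := by omega
  have hm' : (1 : ℝ) ≤ m := by exact_mod_cast hm
  have h1 : 0 < tnm t ζ 0 m := by
    rw [tnm]
    have : ((0 : ℕ) : ℝ) ^ ζ = 0 := by
      rw [Nat.cast_zero, Real.zero_rpow (by linarith)]
    -- For n = 0 the convention log 0 = 0 turns t_{0,m} into t + log(4m) > 0, contradicting
    -- m·t_{0,m} ≤ 0.
    rw [this, mul_zero, zero_mul, Real.logb_zero, zero_add]
    have := Real.log_nonneg (by nlinarith : 1 ≤ 2 * (m : ℝ) * 2)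
    linarith
  have h2 : 0 < (m : ℝ) * tnm t ζ 0 m := by positivity
  simp only [Nat.cast_zero] at h
  linarith

theorem le_tnm (hζ : 1 ≤ ζ) (hm : 1 ≤ m) (hn : 0 < n) :
    t + Real.log (8 * m) ≤ tnm t ζ n m := by
  have hm' : (1 : ℝ) ≤ m := by exact_mod_cast hm
  have hn' : (1 : ℝ) ≤ n := by exact_mod_cast hn
  rw [tnm]
  have h1 := Real.one_le_rpow hn' (by linarith : 0 ≤ ζ)
  have h2 := Real.one_le_rpow hm' (by linarith : 0 ≤ 3 / 2 * ζ)
  have h3 : (4 : ℝ) ≤ 4 * (n : ℝ) ^ ζ * (m : ℝ) ^ (3 / 2 * ζ) := by nlinarith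
  have h4 : (2 : ℝ) ≤ Real.logb 2 (4 * (n : ℝ) ^ ζ * (m : ℝ) ^ (3 / 2 * ζ)) := by
    rw [Real.le_logb_iff_rpow_le (by norm_num) (by linarith)]
    norm_num
    linarith
  have h5 : 8 * (m : ℝ) ≤ 2 * m * (Real.logb 2 (4 * (n : ℝ) ^ ζ * (m : ℝ) ^ (3 / 2 * ζ)) + 2) := by
    nlinarith
  have := Real.log_le_log (by linarith) h5
  linarith

/-- One unit of the exponent cancels the dimension 2m and produces e^{-t}. The spare quarter gives
(2m)^{-1/4} ≤ 4^{-1/4} < 3/4, leaving room for the second event. -/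
theorem operator_tail_budget (ht : 0 < t) (hm : 2 ≤ m) :
    2 * m * Real.exp (-(5 / 4 * (t + Real.log (2 * m)))) ≤ 3 / 4 * Real.exp (-t) := by
  have hm' : (2 : ℝ) ≤ m := by exact_mod_cast hm
  have hlog : Real.exp (Real.log (2 * m)) = 2 * m := Real.exp_log (by linarith)
  set l := Real.log (2 * m)
  have h1 : Real.exp (-(5 / 4 * (t + l))) = Real.exp (-t) * Real.exp (-l) * Real.exp (-((t + l) / 4)) := by
    rw [← Real.exp_add, ← Real.exp_add]
    congr 1
    ring
  have h2 : 2 * m * Real.exp (-l) = 1 := by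
    rw [← hlog, ← Real.exp_add]
    simp
  have h3 : Real.exp (-((t + l) / 4)) ≤ 3 / 4 := by
    refine le_of_pow_le_pow_left₀ (n := 4) (by norm_num) (by norm_num) ?_
    rw [← Real.exp_nat_mul]
    have h4 : ((4 : ℕ) : ℝ) * -((t + l) / 4) = -t + -l := by push_cast; ring
    have h5 : Real.exp (-l) ≤ 1 / 4 := by
      rw [Real.exp_neg, hlog, ← one_div]
      gcongr
      linarith
    have h6 : Real.exp (-t) ≤ 1 := Real.exp_le_one_iff.2 (by linarith)
    rw [h4, Real.exp_add]
    nlinarith [Real.exp_pos (-t), Real.exp_pos (-l)]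
  rw [h1]
  calc 2 * m * (Real.exp (-t) * Real.exp (-l) * Real.exp (-((t + l) / 4)))
      = (2 * m * Real.exp (-l)) * Real.exp (-((t + l) / 4)) * Real.exp (-t) := by ring
    _ ≤ 3 / 4 * Real.exp (-t) := by
        rw [h2, one_mul]
        gcongr

/-- The vector lives in dimension m², so two factors 1/(8m) from e^{-4T} are enough to beat m² + 1.
-/
theorem support_tail_budget (ht : 0 < t) (hm : 1 ≤ m) {T : ℝ} (hT : t + Real.log (8 * m) ≤ T) :
    (m * m + 1 : ℝ) * Real.exp (-(4 * T)) ≤ 1 / 4 * Real.exp (-t) := by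
  have hm' : (1 : ℝ) ≤ m := by exact_mod_cast hm
  have hlog : Real.exp (Real.log (8 * m)) = 8 * m := Real.exp_log (by linarith)
  set l := Real.log (8 * m) with hl
  have hl0 : 0 ≤ l := Real.log_nonneg (by linarith)
  have h1 : Real.exp (-(4 * T)) ≤ Real.exp (-t) * (Real.exp (-l) * Real.exp (-l)) := by
    rw [← Real.exp_add, ← Real.exp_add]
    exact Real.exp_le_exp.2 (by linarith)
  have h2 : Real.exp (-l) = 1 / (8 * m) := by rw [Real.exp_neg, hlog, one_div]
  rw [h2] at h1
  have h3 : (m * m + 1 : ℝ) * (1 / (8 * m) * (1 / (8 * m))) ≤ 1 / 4 := by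
    have : (1 : ℝ) / (8 * m) * (1 / (8 * m)) = 1 / (64 * (m * m)) := by field_simp; norm_num
    rw [this, mul_one_div, div_le_iff₀ (by positivity)]
    nlinarith
  calc (m * m + 1 : ℝ) * Real.exp (-(4 * T))
      ≤ (m * m + 1 : ℝ) * (Real.exp (-t) * (1 / (8 * m) * (1 / (8 * m)))) := by gcongr
    _ = ((m * m + 1 : ℝ) * (1 / (8 * m) * (1 / (8 * m)))) * Real.exp (-t) := by ring
    _ ≤ 1 / 4 * Real.exp (-t) := by gcongr

/-- The error bound for the penalized least squares estimator, with explicit constants. -/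
theorem penalized_estimator_error_bound {c : ℝ} (hc : 0 < c) {V : Type*} [Fintype V]
    [DecidableEq V] [MeasurableSpace V] [MeasurableSingletonClass V]
    {W : Matrix V V ℝ} {lam : ℕ → ℝ} {φ : ℕ → EuclideanSpace ℝ V} {k₀ : ℕ} {ζ : ℝ}
    {S : SymKernel V} {D : Set (SymKernel V)} {n : ℕ} {t : ℝ}
    {Ω : Type*} [MeasurableSpace Ω] {μ : Measure Ω} [IsProbabilityMeasure μ]
    {X X' : Fin n → Ω → V} {Y : Fin n → Ω → ℝ} (hspec : IsSpectralRepresentation W lam φ)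
    (hζ : 1 ≤ ζ) (hreg : SpectrumRegular (Fintype.card V) lam k₀ c ζ)
    (hrank : 1 ≤ (S : Matrix V V ℝ).rank) (hD : Convex ℝ D) (hSD : S ∈ D)
    (hsample : IsSimilaritySample μ S X X' Y) (ht : 0 < t)
    (hn : (Fintype.card V : ℝ) * tnm t ζ n (Fintype.card V) ≤ n) {s : ℕ}
    (hs : s ∈ Finset.Icc (k₀ + 1) (Fintype.card V + 1)) {ε' : ℝ}
    (hε' : invEigenvalue (Fintype.card V) lam s ≤ ε') {Shat : Ω → SymKernel V}
    (hShat : ∀ ω, Shat ω ∈ D ∧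
      IsMinOn (penalizedRisk W (nuclearPenalty t n (Fintype.card V)) ε'
        (fun j => X j ω) (fun j => X' j ω) (fun j => Y j ω)) D (Shat ω)) :
    1 - Real.exp (-t) ≤ μ.real {ω |
      l2NormSq ((Shat ω : Matrix V V ℝ) - (S : Matrix V V ℝ)) ≤
        408 * (1 + c) * (coherence (kernelSupport S) φ s * Fintype.card V
              * tnm t ζ n (Fintype.card V) / n)
        + ε' * l2NormSq (sqrtMatrix W * (S : Matrix V V ℝ))
        + 1600 * maxLeverage (kernelSupport S)
            * (Fintype.card V * tnm t ζ n (Fintype.card V) / n) ^ 2} := by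
  classical
  have hcard : 1 ≤ Fintype.card V := by
    obtain ⟨⟨h1, -⟩, -⟩ := hreg.isLeast
    have := Finset.mem_Icc.1 h1
    omega
  have hne : Nonempty V := Fintype.card_pos_iff.1 hcard
  have hnpos : 0 < n := pos_of_mul_tnm_le ht hζ hcard hn
  have hS0 : (S : Matrix V V ℝ) ≠ 0 := by
    intro h
    rw [h, Matrix.rank_zero] at hrank
    omega
  have hp : ∀ τ, 0 ≤ tripleLaw S τ := (hsample.triple ⟨0, hnpos⟩).tripleLaw_nonneg
  have hTge := le_tnm (t := t) hζ hcard hnpos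
  have hsplus := Finset.mem_Icc.1 hs
  have hε0 : 0 ≤ ε' := by
    refine le_trans ?_ hε'
    rw [invEigenvalue]
    split_ifs with h
    · exact inv_nonneg.2 (hspec.nonneg s (Finset.mem_Icc.2 ⟨by omega, h⟩))
    · exact le_rfl
  set T := tnm t ζ n (Fintype.card V)
  set m := (Fintype.card V : ℝ) with hm
  have hm1 : (1 : ℝ) ≤ m := by rw [hm]; exact_mod_cast hcard
  have hn' : (0 : ℝ) < n := by exact_mod_cast hnpos
  set τ₀ := t + Real.log (2 * m) with hτ₀
  have hτpos : 0 < τ₀ := by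
    have := Real.log_nonneg (by linarith : 1 ≤ 2 * m); linarith
  have hτT : τ₀ ≤ T := by
    have := Real.log_le_log (by linarith) (by linarith : 2 * m ≤ 8 * m)
    linarith
  have hTpos : 0 < T := hτpos.trans_le hτT
  set ε := nuclearPenalty t n (Fintype.card V) with hεdef
  have hεeq : ε = 4 * √(τ₀ / (n * m)) := rfl
  have hε : 0 ≤ ε := by rw [hεeq]; positivity
  have hεsq : ε ^ 2 = 16 * (τ₀ / (n * m)) := by
    rw [hεeq, mul_pow, Real.sq_sqrt (by positivity)]; norm_num
  have hlam : ∀ k : Finset.Icc 1 (Fintype.card V), 0 ≤ lam k := fun k => hspec.nonneg k k.2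
  have ha : ∀ k : Finset.Icc 1 (Fintype.card V), 1 ≤ 1 + ε' * lam k := fun k => by
    have := mul_nonneg hε0 (hlam k); linarith
  set Ξ : (Fin n → V × V × Bool) → Matrix V V ℝ :=
    fun z => (1 / n : ℝ) • ∑ j, noiseMatrix S (z j) with hΞ
  set P := supportProj S
  set Q := ∑ k : Finset.Icc 1 (Fintype.card V), (φ k).ofLp ⬝ᵥ P *ᵥ (φ k).ofLp / (1 + ε' * lam k)
    with hQ
  have hQcoh : Q ≤ (1 + c) * coherence (kernelSupport S) φ s := by
    refine le_trans (le_of_eq ?_)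
      (sum_projection_div_le_coherence (kernelSupport S) hc.le hspec hreg hs hε0 hε')
    simp only [norm_sq_kernelSupport_starProjection]
    rw [← Finset.sum_coe_sort]
  set L := maxLeverage (kernelSupport S)
  obtain ⟨B₁, hB₁, hgood₁⟩ : ∃ B₁ : Finset (Fin n → V × V × Bool),
      ∑ z ∈ B₁, ∏ j, tripleLaw S (z j) ≤ 3 / 4 * Real.exp (-t) ∧
      ∀ z ∉ B₁, ∀ w, |((1 - P) *ᵥ w) ⬝ᵥ Ξ z *ᵥ ((1 - P) *ᵥ w)| ≤ ε / 2 * (w ⬝ᵥ w) := by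
    rcases Nat.lt_or_ge (Fintype.card V) 2 with h2 | h2
    · refine ⟨∅, by simp only [Finset.sum_empty]; positivity, fun z _ w => ?_⟩
      rw [one_sub_supportProj_eq_zero S hS0 (by omega), Matrix.zero_mulVec, zero_dotProduct,
        abs_zero]
      exact mul_nonneg (by positivity) (dotProduct_self_nonneg' w)
    · refine ⟨Finset.univ.filter fun z => ∃ w, 2 * √(τ₀ / (n * m)) * (w ⬝ᵥ w) < |w ⬝ᵥ Ξ z *ᵥ w|,
        ?_, fun z hz w => ?_⟩
      · exact (noise_operator_tail hp h2 hτpos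
          ((mul_le_mul_of_nonneg_left hτT (by positivity)).trans hn) _
          (fun z hz => (Finset.mem_filter.1 hz).2)).trans (operator_tail_budget ht h2)
      · simp only [Finset.mem_filter, Finset.mem_univ, true_and, not_exists, not_lt] at hz
        refine (hz _).trans ?_
        have h3 : 2 * √(τ₀ / (n * m)) = ε / 2 := by rw [hεeq]; ring
        rw [h3]
        exact mul_le_mul_of_nonneg_left (compl_supportProj_mulVec_le S w) (by positivity)
  obtain ⟨B₂, hB₂, hgood₂⟩ : ∃ B₂ : Finset (Fin n → V × V × Bool),
      ∑ z ∈ B₂, ∏ j, tripleLaw S (z j) ≤ 1 / 4 * Real.exp (-t) ∧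
      ∀ z ∉ B₂, ∑ k : Finset.Icc 1 (Fintype.card V), (Ξ z *ᵥ P *ᵥ (φ k).ofLp)
        ⬝ᵥ (Ξ z *ᵥ P *ᵥ (φ k).ofLp) / (1 + ε' * lam k)
        ≤ 50 * (Q * T / (n * m) + 4 * L * T ^ 2 / n ^ 2) := by
    refine ⟨Finset.univ.filter fun z => 50 * (Q * T / (n * m) + 4 * L * T ^ 2 / n ^ 2)
      < ∑ k : Finset.Icc 1 (Fintype.card V), (Ξ z *ᵥ P *ᵥ (φ k).ofLp)
        ⬝ᵥ (Ξ z *ᵥ P *ᵥ (φ k).ofLp) / (1 + ε' * lam k), ?_, fun z hz => ?_⟩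
    · refine (noise_support_tail hp hS0 hspec.trace_eq ha hTpos hnpos hQ _
        (fun z hz => (Finset.mem_filter.1 hz).2)).trans ?_
      have hK : Fintype.card (Finset.Icc 1 (Fintype.card V)) = Fintype.card V := by simp
      rw [hK]
      exact support_tail_budget ht hcard hTge
    · simpa only [Finset.mem_filter, Finset.mem_univ, true_and, not_lt] using hz
  obtain ⟨hmeas, hprob⟩ := hsample.measureReal_encode_mem (B₁ ∪ B₂)
  set bad := {ω | (fun j => encodeTriple (X j ω, X' j ω, Y j ω)) ∈ B₁ ∪ B₂} with hbad
  have hbadle : μ.real bad ≤ Real.exp (-t) := by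
    rw [hprob]
    have h1 : ∑ z ∈ B₁ ∪ B₂, ∏ j, tripleLaw S (z j)
        ≤ ∑ z ∈ B₁, ∏ j, tripleLaw S (z j) + ∑ z ∈ B₂, ∏ j, tripleLaw S (z j) := by
      rw [← Finset.sum_union_inter]
      exact le_add_of_nonneg_right
        (Finset.sum_nonneg fun z _ => Finset.prod_nonneg fun j _ => hp _)
    linarith
  have hcompl : μ.real badᶜ = 1 - μ.real bad := MeasureTheory.probReal_compl_eq_one_sub hmeas
  -- Only the encoded bad event needs to be measurable: monotonicity transfers the bound to the
  -- error event, even if ω ↦ `Shat ω` is not measurable.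
  refine le_trans (by linarith : 1 - Real.exp (-t) ≤ μ.real badᶜ)
    (MeasureTheory.measureReal_mono fun ω hω => ?_)
  set z := fun j => encodeTriple (X j ω, X' j ω, Y j ω) with hz
  have hz12 : z ∉ B₁ ∧ z ∉ B₂ := by
    have : z ∉ B₁ ∪ B₂ := hω
    simpa only [Finset.mem_union, not_or] using this
  have horacle := oracle_inequality hspec.posSemidef hε hε0 hD hSD (hShat ω).1 (hShat ω).2 hlam
    hspec.trace_eq hspec.mulVec_eq hcard
    (sum_noiseMatrix_eq S hnpos (fun j => X j ω) (fun j => X' j ω)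
      (fun j => (hsample.triple j).label ω)) (hgood₁ z hz12.1)
  have h2 := hgood₂ z hz12.2
  refine horacle.trans ?_
  -- Origin of the constants: 400 = 8·50 and 1600 = 8·50·4 from the support noise, and 8 = 16/2 from
  -- ε²/2; τ₀ ≤ T then gives 408.
  have h3 : m ^ 2 * (8 * (50 * (Q * T / (n * m) + 4 * L * T ^ 2 / n ^ 2))
      + ε ^ 2 / 2 * Q) = (400 * T + 8 * τ₀) * Q * m / n + 1600 * L * (m * T / n) ^ 2 := by
    rw [hεsq]
    field_simp
    ring
  have hQ0 : 0 ≤ Q := Finset.sum_nonneg fun k _ => by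
    refine div_nonneg ?_ (zero_le_one.trans (ha k))
    rw [← supportProj_mulVec_dotProduct_self]
    exact dotProduct_self_nonneg' _
  have h4 : (400 * T + 8 * τ₀) * Q * m / n
      ≤ 408 * (1 + c) * (coherence (kernelSupport S) φ s * m * T / n) := by
    calc (400 * T + 8 * τ₀) * Q * m / n ≤ (408 * T) * Q * m / n := by
          gcongr
          linarith
      _ ≤ (408 * T) * ((1 + c) * coherence (kernelSupport S) φ s) * m / n := by gcongr
      _ = 408 * (1 + c) * (coherence (kernelSupport S) φ s * m * T / n) := by ring
  have h5 := mul_le_mul_of_nonneg_left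
    (add_le_add_left (mul_le_mul_of_nonneg_left h2 (by norm_num : (0 : ℝ) ≤ 8)) (ε ^ 2 / 2 * Q))
    (by positivity : 0 ≤ m ^ 2)
  rw [h3] at h5
  linarith

end MainBound

theorem theorem3 (c : ℝ) (hc : 0 < c) :
    ∃ C C₁ : ℝ, 0 < C ∧ 0 < C₁ ∧
      ∀ (V : Type*) [Fintype V] [DecidableEq V] [MeasurableSpace V] [MeasurableSingletonClass V]
        (W : Matrix V V ℝ) (lam : ℕ → ℝ) (φ : ℕ → EuclideanSpace ℝ V) (k₀ : ℕ) (ζ : ℝ)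
        (Sstar : SymKernel V) (D : Set (SymKernel V)) (n : ℕ) (t : ℝ)
        (Ω : Type*) [MeasurableSpace Ω] (μ : MeasureTheory.Measure Ω)
        [MeasureTheory.IsProbabilityMeasure μ]
        (X X' : Fin n → Ω → V) (Y : Fin n → Ω → ℝ),
        IsSpectralRepresentation W lam φ →
        1 ≤ ζ →
        SpectrumRegular (Fintype.card V) lam k₀ c ζ →
        1 ≤ (Sstar : Matrix V V ℝ).rank →
        IsClosed D → Convex ℝ D → Sstar ∈ D →
        IsSimilaritySample μ Sstar X X' Y →
        0 < t →
        (Fintype.card V : ℝ) * tnm t ζ n (Fintype.card V) ≤ n →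
        ∀ s ∈ Finset.Icc (k₀ + 1) (Fintype.card V + 1),
        ∀ ε' ∈ Set.Icc (invEigenvalue (Fintype.card V) lam s)
          (invEigenvalue (Fintype.card V) lam (s - 1)),
        ∀ Shat : Ω → SymKernel V,
          (∀ ω, Shat ω ∈ D ∧
            IsMinOn (penalizedRisk W (nuclearPenalty t n (Fintype.card V)) ε'
              (fun j => X j ω) (fun j => X' j ω) (fun j => Y j ω)) D (Shat ω)) →
          1 - Real.exp (-t) ≤ μ.real {ω |
            l2NormSq ((Shat ω : Matrix V V ℝ) - (Sstar : Matrix V V ℝ)) ≤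
              C * (coherence (kernelSupport Sstar) φ s * Fintype.card V
                    * tnm t ζ n (Fintype.card V) / n)
              + ε' * l2NormSq (sqrtMatrix W * (Sstar : Matrix V V ℝ))
              + C₁ * maxLeverage (kernelSupport Sstar)
                  * (Fintype.card V * tnm t ζ n (Fintype.card V) / n) ^ 2} := by
  refine ⟨408 * (1 + c), 1600, by positivity, by norm_num, ?_⟩
  intro V _ _ _ _ W lam φ k₀ ζ Sstar D n t Ω _ μ _ X X' Y hspec hζ hreg hrank _ hD hSD hsample ht
    hn s hs ε' hε' Shat hShat
  exact penalized_estimator_error_bound hc hspec hζ hreg hrank hD hSD hsample ht hn hs hε'.1 hShat
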